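/- A \emph{hexagonal system} $H$ is a finite subgraph of the infinite hexagonal lattice in the plane (the tiling by regular hexagons of side length one) formed by a cycle of the lattice together with all vertices and edges in its interior; it is \emph{Kekuléan} if it has a perfect matching. A \emph{Clar cover} of $H$ is a spanning subgraph of $H$ each component of which is either a hexagon or a single edge. Let $z(H,k)$ be the number of Clar covers of $H$ with exactly $k$ hexagons, let $\mathrm{Cl}(H)$ be the largest number of hexagons in a Clar cover of $H$, and let $\zeta(H,x)=\sum_{k=0}^{\mathrm{Cl}(H)} z(H,k)\,x^k$ be the Clar covering polynomial of $H$. Let $H$ be a Kekuléan hexagonal system. Then: (1) $\zeta(H,x)$ has no real root in $[-1,+\infty)$; (2) $\zeta(H,x)$ has a real root in the interval $[-2,-1)$; (3) if a rational number $a$ is a root of $\zeta(H,x)$, then $a=-\frac{t+1}{t}$ for some integer $t\ge 1$. -/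

import Mathlib

/-- Vertices of the infinite hexagonal lattice. The centres of the hexagons form the triangular
lattice `ℤ × ℤ` (the point `(i, j)` sits at `i * a + j * b`, where `a` and `b` are two vectors of
length `√3` at angle `π / 3`), and the vertices of the hexagonal lattice are the centres of its
triangles: `(i, j, false)` is the centre of the triangle with corners `(i, j)`, `(i + 1, j)`,
`(i, j + 1)`, and `(i, j, true)` is the centre of the triangle with corners `(i + 1, j)`,
`(i, j + 1)`, `(i + 1, j + 1)`. -/
abbrev HexVertex : Type := ℤ × ℤ × Bool

/-- The hexagons (faces) of the infinite hexagonal lattice, indexed by their centres. -/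
abbrev HexFace : Type := ℤ × ℤ

/-- The three hexagons incident with a vertex: the corners of the corresponding triangle. -/
def HexVertex.faces : HexVertex → Set HexFace
  | (i, j, false) => {(i, j), (i + 1, j), (i, j + 1)}
  | (i, j, true) => {(i + 1, j), (i, j + 1), (i + 1, j + 1)}

/-- The infinite hexagonal lattice: `(i, j, false)` is adjacent to `(i, j, true)`,
`(i - 1, j, true)` and `(i, j - 1, true)` (the triangles that share a side with its triangle). -/
def hexLattice : SimpleGraph HexVertex :=
  SimpleGraph.fromRel fun u v =>
    ∃ i j : ℤ, u = (i, j, false) ∧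
      (v = (i, j, true) ∨ v = (i - 1, j, true) ∨ v = (i, j - 1, true))

/-- The six vertices of a hexagon. -/
def HexFace.verts (c : HexFace) : Set HexVertex := {v | c ∈ v.faces}

/-- The six edges of a hexagon: the lattice edges that join two of its vertices. -/
def HexFace.edges (c : HexFace) : Set (Sym2 HexVertex) :=
  {e | e ∈ hexLattice.edgeSet ∧ ∀ v ∈ e, v ∈ c.verts}

/-- The graph on the hexagons of the lattice in which two different hexagons are joined if they
share an edge that does not lie on the closed walk `p`. -/
def faceGraphAvoiding {u : HexVertex} (p : hexLattice.Walk u u) : SimpleGraph HexFace where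
  Adj c d := c ≠ d ∧ ∃ e, e ∈ c.edges ∧ e ∈ d.edges ∧ e ∉ p.edges
  symm := ⟨fun _ _ ⟨hne, e, hc, hd, hp⟩ => ⟨hne.symm, e, hd, hc, hp⟩⟩
  loopless := ⟨fun _ h => h.1 rfl⟩

/-- A hexagon lies in the interior of the cycle `p` if it belongs to a bounded component of the
complement of `p`, i.e. if only finitely many hexagons can be reached from it by passing from
hexagon to hexagon through common edges that do not lie on `p`. -/
def IsInteriorFace {u : HexVertex} (p : hexLattice.Walk u u) (c : HexFace) : Prop :=
  {d : HexFace | (faceGraphAvoiding p).Reachable c d}.Finite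

/-- The subgraph of the hexagonal lattice formed by the cycle `p` together with its interior. -/
def cycleWithInterior {u : HexVertex} (p : hexLattice.Walk u u) : hexLattice.Subgraph where
  verts := {v | v ∈ p.support ∨ ∃ c, IsInteriorFace p c ∧ v ∈ c.verts}
  Adj v w := s(v, w) ∈ p.edges ∨ ∃ c, IsInteriorFace p c ∧ s(v, w) ∈ c.edges
  adj_sub := by
    rintro v w (h | ⟨c, _, h⟩)
    · exact p.adj_of_mem_edges h
    · exact h.1
  edge_vert := by
    rintro v w (h | ⟨c, hc, h⟩)
    · exact Or.inl (p.fst_mem_support_of_mem_edges h)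
    · exact Or.inr ⟨c, hc, h.2 v (Sym2.mem_mk_left v w)⟩
  symm := ⟨by
    intro v w h
    rwa [Sym2.eq_swap]⟩

/-- A hexagonal system: a finite subgraph of the infinite hexagonal lattice formed by a cycle
together with its interior. -/
def IsHexagonalSystem (H : hexLattice.Subgraph) : Prop :=
  H.verts.Finite ∧ ∃ (u : HexVertex) (p : hexLattice.Walk u u), p.IsCycle ∧
    H = cycleWithInterior p

/-- `H` is Kekuléan if it has a perfect matching. -/
def IsKekulean (H : hexLattice.Subgraph) : Prop :=
  ∃ M : H.coe.Subgraph, M.IsPerfectMatching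

namespace ClarCover

variable {H : hexLattice.Subgraph}

/-- The component `K` of `C` is a hexagon: its vertices are those of a hexagon of the lattice, and
all edges of that hexagon belong to `C`. -/
def IsHexagonComponent (C : SimpleGraph H.verts) (K : C.ConnectedComponent) : Prop :=
  ∃ c : HexFace, Subtype.val '' K.supp = c.verts ∧
    ∀ v ∈ K.supp, ∀ w ∈ K.supp, hexLattice.Adj v.1 w.1 → C.Adj v w

/-- The component `K` of `C` is a single edge. -/
def IsEdgeComponent (C : SimpleGraph H.verts) (K : C.ConnectedComponent) : Prop :=
  ∃ v w, C.Adj v w ∧ K.supp = {v, w}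

end ClarCover

/-- A Clar cover of `H`: a spanning subgraph of `H` (a graph on all vertices of `H`, with edges
from `H`) every component of which is a hexagon or an edge. -/
def IsClarCover (H : hexLattice.Subgraph) (C : SimpleGraph H.verts) : Prop :=
  C ≤ H.coe ∧ ∀ K : C.ConnectedComponent,
    ClarCover.IsHexagonComponent C K ∨ ClarCover.IsEdgeComponent C K

/-- The number of hexagons of a Clar cover. -/
noncomputable def ClarCover.hexagonCount {H : hexLattice.Subgraph} (C : SimpleGraph H.verts) : ℕ :=
  {K : C.ConnectedComponent | ClarCover.IsHexagonComponent C K}.ncard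

/-- The number `z(H, k)` of Clar covers of `H` with exactly `k` hexagons. -/
noncomputable def clarCoverCount (H : hexLattice.Subgraph) (k : ℕ) : ℕ :=
  {C : SimpleGraph H.verts | IsClarCover H C ∧ ClarCover.hexagonCount C = k}.ncard

/-- The Clar number of `H`: the largest number of hexagons in a Clar cover of `H`. -/
noncomputable def clarNumber (H : hexLattice.Subgraph) : ℕ :=
  sSup {k | ∃ C : SimpleGraph H.verts, IsClarCover H C ∧ ClarCover.hexagonCount C = k}

/-- The Clar covering polynomial `ζ(H, x) = ∑_{k = 0}^{Cl(H)} z(H, k) x ^ k`. -/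
noncomputable def clarCoveringPolynomial (H : hexLattice.Subgraph) : Polynomial ℤ :=
  ∑ k ∈ Finset.range (clarNumber H + 1),
    Polynomial.C (clarCoverCount H k : ℤ) * Polynomial.X ^ k

/-! Put y = x + 1. A Clar cover amounts to a perfect matching together with a set of its proper
sextets: on each hexagon of the cover, keep the three edges that have it on the right
(`ClarCover.toMatching`, `ClarCover.ofMatching`). Hence ζ(H, x) is the sum over all perfect
matchings of y to the number of proper sextets (`clarCoveringPolynomial_eq`).

The perfect matchings form a finite distributive lattice. The difference of two of them is a flow
without sources, so it is the gradient of a unique finitely supported height on the hexagons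
(`exists_hexGrad_eq`), and the heights of matchings are closed under pointwise maximum and minimum.
Rotating a proper sextet lowers the height by one at one hexagon, and these rotations are exactly
the covering relations. The crux is `exists_forall_matched`: if no rotation led from a matching
towards a smaller one, some closed walk through interior hexagons would cross only unmatched edges,
always with the black end on the same side. Summation by parts against its winding numbers excludes
this.

So the exponent is a number of lower covers. By Birkhoff's theorem the sum becomes a sum over
antichains of the poset of sup-irreducible elements, which is the independence polynomial I(y) of
its comparability graph. The graph is nonempty because H has a second perfect matching
(`exists_isMatchingIndicator_ne`).

Finally, I has nonnegative coefficients and constant term 1, so it has no root y ≥ 0, and its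
rational roots are of the form -1/t. If I were positive on [-1, 0], it would be bounded there by the
polynomial of every induced subgraph (`aeval_indepPoly_le_of_subset`), in particular by 1 + y, which
vanishes at -1; so I has a root in [-1, 0). -/

open Polynomial

/-! ### Independence polynomials -/

open Classical in
/-- The generating polynomial, by cardinality, of the subsets of `S` whose elements are pairwise
related by `r` (the independence polynomial of the graph `¬ r` on `S`). -/
noncomputable def indepPoly {V : Type*} (r : V → V → Prop) (S : Finset V) : ℤ[X] :=
  ∑ T ∈ S.powerset.filter (fun T : Finset V => (T : Set V).Pairwise r), X ^ T.card

section IndepPoly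

variable {V : Type*} {r : V → V → Prop}

-- Vertex deletion: an independent set either avoids `v`, or consists of `v` and an independent set
-- of vertices compatible with `v`.
open Classical in
theorem indepPoly_insert [Std.Symm r] {v : V} {S : Finset V} (hv : v ∉ S) :
    indepPoly r (insert v S) = indepPoly r S + X * indepPoly r (S.filter (r v)) := by
  unfold indepPoly
  rw [Finset.powerset_insert, Finset.filter_union, Finset.sum_union]
  · congr 1
    rw [Finset.mul_sum]
    symm
    refine Finset.sum_bij (fun T _ => insert v T) ?_ ?_ ?_ ?_
    · intro T hT
      simp only [Finset.mem_filter, Finset.mem_powerset, Finset.mem_image] at hT ⊢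
      refine ⟨⟨T, fun x hx => (Finset.mem_filter.1 (hT.1 hx)).1, rfl⟩, ?_⟩
      rw [Finset.coe_insert, Set.pairwise_insert_of_symm]
      exact ⟨hT.2, fun b hb _ => (Finset.mem_filter.1 (hT.1 hb)).2⟩
    · intro T hT T' hT' h
      simp only [Finset.mem_filter, Finset.mem_powerset] at hT hT'
      have h1 : v ∉ T := fun h => hv (Finset.mem_filter.1 (hT.1 h)).1
      have h2 : v ∉ T' := fun h => hv (Finset.mem_filter.1 (hT'.1 h)).1
      rw [← Finset.erase_insert h1, ← Finset.erase_insert h2, h]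
    · intro U hU
      simp only [Finset.mem_filter, Finset.mem_powerset, Finset.mem_image] at hU
      obtain ⟨⟨T, hT, rfl⟩, hp⟩ := hU
      rw [Finset.coe_insert, Set.pairwise_insert_of_symm] at hp
      refine ⟨T, ?_, rfl⟩
      simp only [Finset.mem_filter, Finset.mem_powerset]
      refine ⟨fun x hx => Finset.mem_filter.2 ⟨hT hx, hp.2 x hx ?_⟩, hp.1⟩
      rintro rfl
      exact hv (hT hx)
    · intro T hT
      simp only [Finset.mem_filter, Finset.mem_powerset] at hT
      have h1 : v ∉ T := fun h => hv (Finset.mem_filter.1 (hT.1 h)).1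
      rw [Finset.card_insert_of_notMem h1, pow_succ, mul_comm]
  · rw [Finset.disjoint_left]
    intro T hT hT'
    simp only [Finset.mem_filter, Finset.mem_powerset, Finset.mem_image] at hT hT'
    obtain ⟨⟨U, hU, rfl⟩, -⟩ := hT'
    exact hv (hT.1 (Finset.mem_insert_self _ _))

theorem indepPoly_empty : indepPoly r ∅ = 1 := by
  classical
  simp [indepPoly, Finset.filter_singleton]

theorem indepPoly_coeff_zero (S : Finset V) : (indepPoly r S).coeff 0 = 1 := by
  classical
  unfold indepPoly
  rw [finsetSum_coeff, Finset.sum_eq_single ∅]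
  · simp
  · intro T _ hT
    have : T.card ≠ 0 := by simpa using hT
    simp [coeff_X_pow, this.symm]
  · intro h
    simp at h

theorem aeval_indepPoly_zero (S : Finset V) : aeval (0 : ℝ) (indepPoly r S) = 1 := by
  rw [← coeff_zero_eq_aeval_zero', indepPoly_coeff_zero]
  simp

/-- If `indepPoly r S` is positive on `[a, 0]`, then every subset of `S` has at least as large an
independence polynomial there. -/
theorem aeval_indepPoly_le_of_subset [Std.Symm r] (n : ℕ) :
    ∀ (S : Finset V), S.card ≤ n → ∀ a : ℝ,
      (∀ t ∈ Set.Icc a 0, 0 < aeval t (indepPoly r S)) →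
      ∀ T ⊆ S, ∀ t ∈ Set.Icc a 0, aeval t (indepPoly r S) ≤ aeval t (indepPoly r T) := by
  classical
  induction n with
  | zero =>
    intro S hS a _ T hT t _
    have : S = ∅ := by simpa using hS
    subst this
    rw [Finset.subset_empty.1 hT]
  | succ n ih =>
    intro S hS a hpos T hT t ht
    rcases eq_or_ne T S with rfl | hne
    · rfl
    obtain ⟨v, hvS, hvT⟩ : ∃ v ∈ S, v ∉ T := by
      by_contra! h
      exact hne (Finset.Subset.antisymm hT h)
    have hS' : insert v (S.erase v) = S := Finset.insert_erase hvS
    have hrec : ∀ s : ℝ, aeval s (indepPoly r S) =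
        aeval s (indepPoly r (S.erase v)) +
          s * aeval s (indepPoly r ((S.erase v).filter (r v))) := by
      intro s
      rw [← hS', indepPoly_insert (Finset.notMem_erase v S), hS']
      simp
    have hcard : (S.erase v).card ≤ n := by
      rw [Finset.card_erase_of_mem hvS]; omega
    -- Positivity passes to `S - v`. Otherwise take the largest bad point `s < 0`. To its right the
    -- induction hypothesis makes the second term of the recursion nonpositive; in the limit this
    -- holds at `s`, so the polynomial of `S` is nonpositive there.
    have hpos' : ∀ s ∈ Set.Icc a 0, 0 < aeval s (indepPoly r (S.erase v)) := by
      by_contra! hcon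
      let Z : Set ℝ := {s | s ∈ Set.Icc a 0 ∧ aeval s (indepPoly r (S.erase v)) ≤ 0}
      have hZne : Z.Nonempty := hcon
      have hZc : IsCompact Z := by
        refine (isCompact_Icc (a := a) (b := 0)).inter_right ?_
        exact isClosed_le (indepPoly r (S.erase v)).continuous_aeval continuous_const
      obtain ⟨s, hsZ, hsmax⟩ := hZc.exists_isGreatest hZne
      have hs0 : s < 0 := by
        rcases hsZ.1.2.lt_or_eq with h | h
        · exact h
        · have := hsZ.2
          rw [h, aeval_indepPoly_zero] at this
          norm_num at this
      have hright : ∀ u ∈ Set.Ioc s 0,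
          0 ≤ aeval u (indepPoly r ((S.erase v).filter (r v))) := by
        intro u hu
        have hp : ∀ w ∈ Set.Icc u 0, 0 < aeval w (indepPoly r (S.erase v)) := by
          intro w hw
          by_contra hle
          have : w ≤ s := hsmax ⟨⟨hsZ.1.1.trans (hu.1.le.trans hw.1), hw.2⟩, not_lt.1 hle⟩
          linarith [hu.1, hw.1]
        exact (hp u ⟨le_rfl, hu.2⟩).le.trans
          (ih _ hcard u hp _ (Finset.filter_subset _ _) u ⟨le_rfl, hu.2⟩)
      -- The induction hypothesis needs positivity on a closed interval, which fails at `s` itself;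
      -- hence the passage to the closure.
      have hs1 : 0 ≤ aeval s (indepPoly r ((S.erase v).filter (r v))) := by
        have hcl : IsClosed {u : ℝ | 0 ≤ aeval u (indepPoly r ((S.erase v).filter (r v)))} :=
          isClosed_le continuous_const (Polynomial.continuous_aeval _)
        have hsub : closure (Set.Ioc s 0) ⊆
            {u : ℝ | 0 ≤ aeval u (indepPoly r ((S.erase v).filter (r v)))} :=
          closure_minimal hright hcl
        rw [closure_Ioc hs0.ne] at hsub
        exact hsub ⟨le_rfl, hs0.le⟩
      have := hpos s hsZ.1
      rw [hrec s] at this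
      nlinarith [hsZ.2, mul_nonneg (neg_nonneg.2 hs0.le) hs1]
    have h1 := ih _ hcard a hpos' T (fun x hx => Finset.mem_erase.2
      ⟨fun h => hvT (h ▸ hx), hT hx⟩) t ht
    have h2 := ih _ hcard a hpos' _ (Finset.filter_subset (r v) _) t ht
    have h3 := hpos' t ht
    rw [hrec t]
    nlinarith [mul_nonneg (neg_nonneg.2 ht.2) (h3.le.trans h2)]

/-- Without a root the polynomial stays positive on [-1, 0]. Comparison with a single vertex, whose
polynomial 1 + X vanishes at -1, then gives a contradiction. -/
theorem exists_root_indepPoly [Std.Symm r] {S : Finset V} (hS : S.Nonempty) :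
    ∃ y : ℝ, -1 ≤ y ∧ y < 0 ∧ aeval y (indepPoly r S) = 0 := by
  classical
  by_contra! hcon
  have hpos : ∀ t ∈ Set.Icc (-1 : ℝ) 0, 0 < aeval t (indepPoly r S) := by
    intro t ht
    by_contra hle
    have hc : ContinuousOn (fun u : ℝ => aeval u (indepPoly r S)) (Set.Icc t 0) :=
      (Polynomial.continuous_aeval _).continuousOn
    obtain ⟨y, hy, hy0⟩ := intermediate_value_Icc ht.2 hc
      (show (0 : ℝ) ∈ _ from ⟨not_lt.1 hle, by simp [aeval_indepPoly_zero]⟩)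
    simp only at hy0
    rcases hy.2.lt_or_eq with h | h
    · exact hcon y (ht.1.trans hy.1) h hy0
    · rw [h, aeval_indepPoly_zero] at hy0
      norm_num at hy0
  obtain ⟨v, hv⟩ := hS
  have h1 : (-1 : ℝ) ∈ Set.Icc (-1 : ℝ) 0 := by norm_num
  have := aeval_indepPoly_le_of_subset S.card S le_rfl (-1) hpos {v} (by simpa using hv) (-1) h1
  have h2 : aeval (-1 : ℝ) (indepPoly r {v}) = 0 := by
    rw [← insert_empty_eq, indepPoly_insert (by simp)]
    simp [indepPoly_empty]
  have h3 := hpos _ h1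
  linarith

end IndepPoly

/-! ### The cover polynomial of a finite distributive lattice -/

/-- The generating polynomial of the number of lower covers. -/
noncomputable def coverPoly (α : Type*) [Preorder α] [Fintype α] : ℤ[X] :=
  ∑ a : α, X ^ {b : α | b ⋖ a}.ncard

theorem coverPoly_congr {α β : Type*} [Preorder α] [Fintype α] [Preorder β] [Fintype β]
    (e : α ≃o β) : coverPoly α = coverPoly β := by
  unfold coverPoly
  refine Fintype.sum_equiv e.toEquiv _ _ fun a => ?_
  congr 1
  refine Set.ncard_congr (fun b _ => e b) ?_ ?_ ?_
  · intro b hb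
    simpa using hb
  · intro b c _ _ h
    exact e.injective h
  · intro b hb
    refine ⟨e.symm b, ?_, e.apply_symm_apply b⟩
    rw [Set.mem_ofPred_eq, ← apply_covBy_apply_iff e, e.apply_symm_apply]
    exact hb

/-! ### Lower sets, their maximal elements and antichains -/

section LowerSets

variable {P : Type*} [PartialOrder P] [Finite P]

/-- `I.erase x` drops everything above `x`, which is `x` alone when `x` is maximal. By finiteness,
any element of `I` outside `J` lies below a maximal one, and that one is outside `J` too. -/
theorem LowerSet.covBy_iff_exists_maximal {I J : LowerSet P} :
    J ⋖ I ↔ ∃ x, Maximal (· ∈ I) x ∧ I.erase x = J := by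
  constructor
  · intro h
    obtain ⟨y, hyI, hyJ⟩ : ∃ y, y ∈ I ∧ y ∉ J := by
      by_contra! hcon
      exact h.lt.not_ge hcon
    obtain ⟨x, hyx, hx⟩ := (Set.toFinite {z | z ∈ I}).exists_le_maximal hyI
    refine ⟨x, hx, ?_⟩
    have hxJ : x ∉ J := fun hxJ => hyJ (J.lower hyx hxJ)
    have hJ : J ≤ I.erase x := by
      intro z hz
      refine ⟨h.le hz, fun hxz => hxJ (J.lower hxz hz)⟩
    by_contra hne
    exact h.2 (lt_of_le_of_ne hJ (Ne.symm hne)) (LowerSet.erase_lt.2 hx.1)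
  · rintro ⟨x, hx, rfl⟩
    refine ⟨LowerSet.erase_lt.2 hx.1, fun K hK hK' => hK'.not_ge ?_⟩
    have hxK : x ∈ K := by
      by_contra hxK
      exact hK.not_ge fun z hz => ⟨hK'.le hz, fun hxz => hxK (K.lower hxz hz)⟩
    intro z hz
    by_cases hxz : x ≤ z
    · rwa [← hx.eq_of_le hz hxz]
    · exact hK.le ⟨hz, hxz⟩

theorem LowerSet.ncard_covBy (I : LowerSet P) :
    {J : LowerSet P | J ⋖ I}.ncard = {x | Maximal (· ∈ I) x}.ncard := by
  symm
  refine Set.ncard_congr (fun x _ => I.erase x) ?_ ?_ ?_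
  · intro x hx
    exact LowerSet.covBy_iff_exists_maximal.2 ⟨x, hx, rfl⟩
  · intro x y hx hy h
    by_contra hne
    have hxy : ¬ y ≤ x := fun hle => hne (hy.eq_of_le hx.1 hle).symm
    have : x ∈ I.erase y := ⟨hx.1, hxy⟩
    rw [← h] at this
    exact this.2 le_rfl
  · intro J hJ
    obtain ⟨x, hx, h⟩ := LowerSet.covBy_iff_exists_maximal.1 hJ
    exact ⟨x, hx, h⟩

/-- In a finite poset a lower set is determined by the antichain of its maximal elements, every
antichain arises in this way, and removing one maximal element is a covering step. -/
theorem coverPoly_lowerSet [Fintype P] [Fintype (LowerSet P)] :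
    coverPoly (LowerSet P) = indepPoly (fun x y : P => ¬ x ≤ y ∧ ¬ y ≤ x) Finset.univ := by
  classical
  unfold coverPoly indepPoly
  refine Finset.sum_bij (fun I _ => {x | Maximal (· ∈ I) x}.toFinset) ?_ ?_ ?_ ?_
  · intro I _
    simp only [Finset.mem_filter, Finset.mem_powerset, Finset.subset_univ, true_and,
      Set.coe_toFinset]
    intro x hx y hy hne
    exact ⟨fun h => hne (hx.eq_of_le hy.1 h), fun h => hne (hy.eq_of_le hx.1 h).symm⟩
  · intro I _ J _ h
    have h' : ∀ x, Maximal (· ∈ I) x ↔ Maximal (· ∈ J) x := by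
      intro x
      simpa using congrArg (x ∈ ·) h
    have key : ∀ I J : LowerSet P, (∀ x, Maximal (· ∈ I) x ↔ Maximal (· ∈ J) x) → I ≤ J := by
      intro I J h y hy
      obtain ⟨x, hyx, hx⟩ := (Set.toFinite {z | z ∈ I}).exists_le_maximal hy
      exact J.lower hyx ((h x).1 hx).1
    exact le_antisymm (key I J h') (key J I fun x => (h' x).symm)
  · intro T hT
    simp only [Finset.mem_filter, Finset.mem_powerset, Finset.subset_univ, true_and] at hT
    refine ⟨lowerClosure (T : Set P), Finset.mem_univ _, ?_⟩
    ext x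
    simp only [Set.mem_toFinset, Set.mem_ofPred_eq]
    constructor
    · intro hx
      obtain ⟨y, hy, hxy⟩ := mem_lowerClosure.1 hx.1
      have : y ∈ lowerClosure (T : Set P) := subset_lowerClosure hy
      rw [hx.eq_of_le this hxy]
      exact hy
    · intro hx
      refine ⟨subset_lowerClosure hx, fun y hy hxy => ?_⟩
      obtain ⟨z, hz, hyz⟩ := mem_lowerClosure.1 hy
      rcases eq_or_ne x z with rfl | hne
      · exact hyz
      · exact absurd (hxy.trans hyz) (hT hx hz hne).1
  · intro I _
    rw [LowerSet.ncard_covBy, Set.ncard_eq_toFinset_card']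

end LowerSets

-- Birkhoff's representation by lower sets of sup-irreducible elements. Nontriviality guarantees
-- that there is at least one such element.
universe u in
theorem exists_indepPoly_eq_coverPoly (α : Type u) [DistribLattice α] [Fintype α] [Nontrivial α] :
    ∃ (V : Type u) (r : V → V → Prop) (S : Finset V), Std.Symm r ∧ S.Nonempty ∧
      coverPoly α = indepPoly r S := by
  classical
  let : BoundedOrder α := Fintype.toBoundedOrder α
  refine ⟨{a : α // SupIrred a}, fun x y => ¬ x ≤ y ∧ ¬ y ≤ x, Finset.univ,
    ⟨fun x y h => ⟨h.2, h.1⟩⟩, ?_, ?_⟩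
  · by_contra hne
    rw [Finset.univ_nonempty_iff, not_nonempty_iff] at hne
    have : Subsingleton (LowerSet {a : α // SupIrred a}) :=
      ⟨fun I J => LowerSet.ext (Set.ext fun x => hne.elim x)⟩
    have : Subsingleton α := (OrderIso.lowerSetSupIrred (α := α)).injective.subsingleton
    exact not_subsingleton α this
  · let : Fintype (LowerSet {a : α // SupIrred a}) := Fintype.ofFinite _
    rw [coverPoly_congr (OrderIso.lowerSetSupIrred (α := α)), coverPoly_lowerSet]

/-! ### Edges of the hexagonal lattice -/

/-- The edges of the hexagonal lattice: `(i, j, d)` is the edge at the vertex `(i, j, false)` in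
the direction `d`. -/
abbrev HexEdge : Type := ℤ × ℤ × Fin 3

namespace HexEdge

/-- The end of an edge of the form `(i, j, false)`. -/
def black (e : HexEdge) : HexVertex := (e.1, e.2.1, false)

/-- The end of an edge of the form `(i, j, true)`. -/
def white : HexEdge → HexVertex
  | (i, j, 0) => (i, j, true)
  | (i, j, 1) => (i - 1, j, true)
  | (i, j, 2) => (i, j - 1, true)

/-- The hexagon on one side of an edge. -/
def left : HexEdge → HexFace
  | (i, j, 0) => (i + 1, j)
  | (i, j, 1) => (i, j + 1)
  | (i, j, 2) => (i, j)

/-- The hexagon on the other side of an edge. -/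
def right : HexEdge → HexFace
  | (i, j, 0) => (i, j + 1)
  | (i, j, 1) => (i, j)
  | (i, j, 2) => (i + 1, j)

/-- The edge as an unordered pair of vertices. -/
def toSym2 (e : HexEdge) : Sym2 HexVertex := s(e.black, e.white)

/-- The direction of an edge. -/
def dir (e : HexEdge) : Fin 3 := e.2.2

end HexEdge

/-- The three edges at a vertex, indexed by their directions. -/
def HexVertex.star : HexVertex → Fin 3 → HexEdge
  | (i, j, false), d => (i, j, d)
  | (i, j, true), 0 => (i, j, 0)
  | (i, j, true), 1 => (i + 1, j, 1)
  | (i, j, true), 2 => (i, j + 1, 2)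

/-- The three edges with a given hexagon on the left, indexed by their directions. -/
def HexFace.leftEdge : HexFace → Fin 3 → HexEdge
  | (i, j), 0 => (i - 1, j, 0)
  | (i, j), 1 => (i, j - 1, 1)
  | (i, j), 2 => (i, j, 2)

/-- The three edges with a given hexagon on the right, indexed by their directions. -/
def HexFace.rightEdge : HexFace → Fin 3 → HexEdge
  | (i, j), 0 => (i, j - 1, 0)
  | (i, j), 1 => (i, j, 1)
  | (i, j), 2 => (i - 1, j, 2)

theorem fin_three_forall {p : Fin 3 → Prop} : (∀ d, p d) ↔ p 0 ∧ p 1 ∧ p 2 := by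
  constructor
  · intro h
    exact ⟨h 0, h 1, h 2⟩
  · rintro ⟨h0, h1, h2⟩ d
    fin_cases d <;> assumption

theorem HexEdge.forall_iff {p : HexEdge → Prop} :
    (∀ e, p e) ↔ ∀ i j, p (i, j, 0) ∧ p (i, j, 1) ∧ p (i, j, 2) := by
  constructor
  · intro h i j
    exact ⟨h _, h _, h _⟩
  · rintro h ⟨i, j, d⟩
    exact (fin_three_forall (p := fun d => p (i, j, d))).2 (h i j) d

theorem HexVertex.forall_iff {p : HexVertex → Prop} :
    (∀ e, p e) ↔ ∀ i j, p (i, j, false) ∧ p (i, j, true) := by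
  constructor
  · intro h i j
    exact ⟨h _, h _⟩
  · rintro h ⟨i, j, _ | _⟩
    exacts [(h i j).1, (h i j).2]

namespace HexEdge

theorem black_ne_white (e e' : HexEdge) : e.black ≠ e'.white := by
  revert e'
  rw [HexEdge.forall_iff]
  intro i j
  simp [black, white]

theorem left_ne_right (e : HexEdge) : e.left ≠ e.right := by
  revert e
  rw [HexEdge.forall_iff]
  intro i j
  simp [left, right]

theorem star_black (e : HexEdge) : e.black.star e.dir = e := rfl

theorem star_white (e : HexEdge) : e.white.star e.dir = e := by
  revert e
  rw [HexEdge.forall_iff]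
  intro i j
  simp [white, HexVertex.star, dir]

theorem leftEdge_left (e : HexEdge) : e.left.leftEdge e.dir = e := by
  revert e
  rw [HexEdge.forall_iff]
  intro i j
  simp [left, HexFace.leftEdge, dir]

theorem rightEdge_right (e : HexEdge) : e.right.rightEdge e.dir = e := by
  revert e
  rw [HexEdge.forall_iff]
  intro i j
  simp [right, HexFace.rightEdge, dir]

end HexEdge

theorem HexFace.left_leftEdge (c : HexFace) (d : Fin 3) : (c.leftEdge d).left = c := by
  revert d
  rw [fin_three_forall]
  obtain ⟨i, j⟩ := c
  simp [HexEdge.left, HexFace.leftEdge]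

theorem HexFace.right_rightEdge (c : HexFace) (d : Fin 3) : (c.rightEdge d).right = c := by
  revert d
  rw [fin_three_forall]
  obtain ⟨i, j⟩ := c
  simp [HexEdge.right, HexFace.rightEdge]

theorem HexFace.dir_leftEdge (c : HexFace) (d : Fin 3) : (c.leftEdge d).dir = d := by
  revert d
  rw [fin_three_forall]
  obtain ⟨i, j⟩ := c
  simp [HexEdge.dir, HexFace.leftEdge]

theorem HexFace.dir_rightEdge (c : HexFace) (d : Fin 3) : (c.rightEdge d).dir = d := by
  revert d
  rw [fin_three_forall]
  obtain ⟨i, j⟩ := c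
  simp [HexEdge.dir, HexFace.rightEdge]

theorem HexVertex.dir_star (v : HexVertex) (d : Fin 3) : (v.star d).dir = d := by
  revert v d
  rw [HexVertex.forall_iff]
  intro i j
  rw [fin_three_forall, fin_three_forall]
  simp [HexEdge.dir, HexVertex.star]

theorem HexVertex.star_injective (v : HexVertex) : Function.Injective v.star := fun d d' h => by
  rw [← v.dir_star d, h, v.dir_star]

theorem HexVertex.star_end (v : HexVertex) (d : Fin 3) :
    (v.star d).black = v ∨ (v.star d).white = v := by
  revert v d
  rw [HexVertex.forall_iff]
  intro i j
  rw [fin_three_forall, fin_three_forall]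
  simp [HexEdge.black, HexEdge.white, HexVertex.star]

/-- `e` is one of the three edges at `v`. -/
theorem HexVertex.exists_star_eq {v : HexVertex} {e : HexEdge} :
    (∃ d, v.star d = e) ↔ e.black = v ∨ e.white = v := by
  constructor
  · rintro ⟨d, rfl⟩
    exact v.star_end d
  · rintro (rfl | rfl)
    exacts [⟨_, e.star_black⟩, ⟨_, e.star_white⟩]

theorem hexLattice_adj_iff {v w : HexVertex} : hexLattice.Adj v w ↔
    ∃ e : HexEdge, (v = e.black ∧ w = e.white) ∨ (v = e.white ∧ w = e.black) := by
  unfold hexLattice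
  rw [SimpleGraph.fromRel_adj]
  constructor
  · rintro ⟨-, ⟨i, j, rfl, rfl | rfl | rfl⟩ | ⟨i, j, rfl, rfl | rfl | rfl⟩⟩
    exacts [⟨(i, j, 0), Or.inl ⟨rfl, rfl⟩⟩, ⟨(i, j, 1), Or.inl ⟨rfl, rfl⟩⟩,
      ⟨(i, j, 2), Or.inl ⟨rfl, rfl⟩⟩, ⟨(i, j, 0), Or.inr ⟨rfl, rfl⟩⟩,
      ⟨(i, j, 1), Or.inr ⟨rfl, rfl⟩⟩, ⟨(i, j, 2), Or.inr ⟨rfl, rfl⟩⟩]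
  · rintro ⟨e, he⟩
    have key : ∃ i j : ℤ, e.black = (i, j, false) ∧
        (e.white = (i, j, true) ∨ e.white = (i - 1, j, true) ∨ e.white = (i, j - 1, true)) := by
      clear he
      revert e
      rw [HexEdge.forall_iff]
      intro i j
      exact ⟨⟨i, j, rfl, Or.inl rfl⟩, ⟨i, j, rfl, Or.inr (Or.inl rfl)⟩,
        ⟨i, j, rfl, Or.inr (Or.inr rfl)⟩⟩
    rcases he with ⟨rfl, rfl⟩ | ⟨rfl, rfl⟩
    · exact ⟨e.black_ne_white e, Or.inl key⟩
    · exact ⟨(e.black_ne_white e).symm, Or.inr key⟩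

theorem HexEdge.adj (e : HexEdge) : hexLattice.Adj e.black e.white :=
  hexLattice_adj_iff.2 ⟨e, Or.inl ⟨rfl, rfl⟩⟩

theorem HexEdge.toSym2_mem_edgeSet (e : HexEdge) : e.toSym2 ∈ hexLattice.edgeSet := e.adj

theorem HexEdge.exists_toSym2_eq {s : Sym2 HexVertex} (hs : s ∈ hexLattice.edgeSet) :
    ∃ e : HexEdge, e.toSym2 = s := by
  induction s with | _ v w
  obtain ⟨e, ⟨rfl, rfl⟩ | ⟨rfl, rfl⟩⟩ := hexLattice_adj_iff.1 hs
  · exact ⟨e, rfl⟩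
  · exact ⟨e, Sym2.eq_swap⟩

theorem HexEdge.eq_of_black_eq_of_white_eq {e e' : HexEdge} (hb : e.black = e'.black)
    (hw : e.white = e'.white) : e = e' := by
  obtain ⟨i, j, d⟩ := e
  obtain ⟨i', j', d'⟩ := e'
  simp only [black, Prod.mk.injEq, and_true] at hb
  obtain ⟨rfl, rfl⟩ := hb
  revert d d'
  rw [fin_three_forall]
  simp only [fin_three_forall]
  simp [white, sub_eq_self, eq_sub_iff_add_eq]

theorem HexEdge.toSym2_injective : Function.Injective HexEdge.toSym2 := by
  intro e e' h
  rcases Sym2.eq_iff.1 h with ⟨hb, hw⟩ | ⟨hb, -⟩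
  · exact HexEdge.eq_of_black_eq_of_white_eq hb hw
  · exact absurd hb (e.black_ne_white e')

theorem HexFace.mem_verts {c : HexFace} {v : HexVertex} : v ∈ c.verts ↔ c ∈ v.faces := Iff.rfl

theorem HexFace.toSym2_mem_edges {c : HexFace} {e : HexEdge} :
    e.toSym2 ∈ c.edges ↔ e.left = c ∨ e.right = c := by
  have : e.toSym2 ∈ c.edges ↔ e.black ∈ c.verts ∧ e.white ∈ c.verts := by
    constructor
    · intro h
      exact ⟨h.2 _ (Sym2.mem_mk_left _ _), h.2 _ (Sym2.mem_mk_right _ _)⟩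
    · rintro ⟨hb, hw⟩
      refine ⟨e.toSym2_mem_edgeSet, fun v hv => ?_⟩
      rcases Sym2.mem_iff.1 hv with rfl | rfl <;> assumption
  rw [this]
  clear this
  obtain ⟨a, b⟩ := c
  revert e
  rw [HexEdge.forall_iff]
  intro i j
  simp only [HexFace.mem_verts, HexEdge.black, HexEdge.white, HexVertex.faces, HexEdge.left,
    HexEdge.right, Set.mem_insert_iff, Set.mem_singleton_iff, Prod.mk.injEq]
  omega

/-- A vertex of a hexagon has exactly one edge with the hexagon on the left. -/
theorem HexFace.mem_verts_iff_left {c : HexFace} {v : HexVertex} :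
    v ∈ c.verts ↔ ∃ d, (v.star d).left = c := by
  obtain ⟨a, b⟩ := c
  revert v
  rw [HexVertex.forall_iff]
  intro i j
  simp only [HexFace.mem_verts, HexVertex.faces, HexVertex.star, HexEdge.left,
    Set.mem_insert_iff, Set.mem_singleton_iff, Prod.mk.injEq, Fin.exists_fin_succ]
  simp
  omega

theorem HexFace.mem_verts_iff_right {c : HexFace} {v : HexVertex} :
    v ∈ c.verts ↔ ∃ d, (v.star d).right = c := by
  obtain ⟨a, b⟩ := c
  revert v
  rw [HexVertex.forall_iff]
  intro i j
  simp only [HexFace.mem_verts, HexVertex.faces, HexVertex.star, HexEdge.right,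
    Set.mem_insert_iff, Set.mem_singleton_iff, Prod.mk.injEq, Fin.exists_fin_succ]
  simp
  omega

theorem HexVertex.right_star_injective (v : HexVertex) :
    Function.Injective fun d => (v.star d).right := by
  intro d d' h
  simp only at h
  revert v d d'
  rw [HexVertex.forall_iff]
  intro i j
  simp only [fin_three_forall]
  simp [HexVertex.star, HexEdge.right]

/-- Two hexagons at a vertex share at most one edge at this vertex. -/
theorem HexVertex.right_ne_left_of_left_eq_right {v : HexVertex} {d d' : Fin 3}
    (h : (v.star d).left = (v.star d').right) : (v.star d).right ≠ (v.star d').left := by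
  revert v d d'
  rw [HexVertex.forall_iff]
  intro i j
  simp only [fin_three_forall]
  simp [HexVertex.star, HexEdge.left, HexEdge.right]

theorem HexFace.eq_of_verts_subset {c d : HexFace} (h : c.verts ⊆ d.verts) : c = d := by
  obtain ⟨a, b⟩ := c
  obtain ⟨a', b'⟩ := d
  -- Two opposite vertices of the hexagon: the corresponding triangles have only the corner `(a, b)`
  -- in common.
  have h1 := @h (a, b, false) (by simp [HexFace.verts, HexVertex.faces])
  have h2 := @h (a - 1, b - 1, true) (by simp [HexFace.verts, HexVertex.faces])
  simp [HexFace.verts, HexVertex.faces] at h1 h2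
  ext <;> simp only <;> omega

/-! ### Potentials of finitely supported flows -/

/-- The flow of a function on the hexagons. -/
def hexGrad (h : HexFace → ℤ) (e : HexEdge) : ℤ := h e.right - h e.left

/-- Each of the three hexagons at a vertex lies on the left of one edge of the star and on the right
of another, so its contributions cancel. -/
theorem sum_star_hexGrad (h : HexFace → ℤ) (v : HexVertex) : ∑ d, hexGrad h (v.star d) = 0 := by
  revert v
  rw [HexVertex.forall_iff]
  intro i j
  simp only [Fin.sum_univ_three, hexGrad, HexVertex.star, HexEdge.left, HexEdge.right]
  constructor <;> ring

theorem exists_primitive (g : ℤ → ℤ) (a : ℤ) (hg : ∀ k < a, g k = 0) :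
    ∃ G : ℤ → ℤ, (∀ i, G (i + 1) - G i = g i) ∧ ∀ i ≤ a, G i = 0 := by
  refine ⟨fun i => ∑ k ∈ Finset.Ico a i, g k, fun i => ?_, fun i hi => ?_⟩
  · beta_reduce
    rcases lt_or_ge i a with h | h
    · rw [Finset.Ico_eq_empty (by omega), Finset.Ico_eq_empty (by omega), hg i h]
      simp
    · have : Finset.Ico a (i + 1) = insert i (Finset.Ico a i) := by
        ext k
        simp only [Finset.mem_Ico, Finset.mem_insert]
        omega
      rw [this, Finset.sum_insert (by simp)]
      ring
  · simp [Finset.Ico_eq_empty (not_lt.2 hi)]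

theorem Int.eq_of_forall_add_one {u : ℤ → ℤ} {p : ℤ → Prop} (hp : ∀ i, p i → p (i + 1))
    (hu : ∀ i, p i → u (i + 1) = u i) {a : ℤ} (ha : p a) : ∀ i, a ≤ i → u i = u a := by
  intro i hi
  have : p i ∧ u i = u a := by
    induction i, hi using Int.leInduction with
    | base => exact ⟨ha, rfl⟩
    | succ k _ ih => exact ⟨hp k ih.1, (hu k ih.1).trans ih.2⟩
  exact this.2

theorem Int.eq_const_of_forall_add_one {u : ℤ → ℤ} (hu : ∀ i, u (i + 1) = u i) (i j : ℤ) :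
    u i = u j := by
  rcases le_total i j with h | h
  · exact (Int.eq_of_forall_add_one (p := fun _ => True) (fun _ _ => trivial)
      (fun i _ => hu i) trivial j h).symm
  · exact Int.eq_of_forall_add_one (p := fun _ => True) (fun _ _ => trivial)
      (fun i _ => hu i) trivial i h

theorem exists_box_of_finite_support {f : HexEdge → ℤ} (hf : f.support.Finite) :
    ∃ N : ℤ, ∀ i j d, (i < -N ∨ N < i ∨ j < -N ∨ N < j) → f (i, j, d) = 0 := by
  obtain ⟨N, hN⟩ := (hf.image fun e => max |e.1| |e.2.1|).bddAbove
  refine ⟨N, fun i j d h => ?_⟩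
  by_contra hne
  have h1 : max |i| |j| ≤ N := hN ⟨(i, j, d), hne, rfl⟩
  have h2 := abs_le.1 ((le_max_left _ _).trans h1)
  have h3 := abs_le.1 ((le_max_right _ _).trans h1)
  omega

theorem finite_support_of_box {h : ℤ → ℤ → ℤ} {N : ℤ}
    (hN : ∀ i j, (i < -N ∨ N < i ∨ j < -N ∨ N < j) → h i j = 0) :
    (Function.support fun c : ℤ × ℤ => h c.1 c.2).Finite := by
  refine ((Set.finite_Icc (-N) N).prod (Set.finite_Icc (-N) N)).subset ?_
  rintro ⟨i, j⟩ hne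
  by_contra hout
  refine hne (hN i j ?_)
  simp only [Set.mem_prod, Set.mem_Icc] at hout
  omega

/-- A finitely supported flow without sources comes from a finitely supported function on the
hexagons. -/
theorem exists_hexGrad_eq {f : HexEdge → ℤ} (hf : f.support.Finite)
    (hdiv : ∀ v : HexVertex, ∑ d, f (v.star d) = 0) :
    ∃ h : HexFace → ℤ, h.support.Finite ∧ ∀ e, hexGrad h e = f e := by
  obtain ⟨N, hN⟩ := exists_box_of_finite_support hf
  have hb : ∀ i j, f (i, j, 0) + f (i, j, 1) + f (i, j, 2) = 0 := by
    intro i j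
    simpa [Fin.sum_univ_three, HexVertex.star] using hdiv (i, j, false)
  have hw : ∀ i j, f (i, j, 0) + f (i + 1, j, 1) + f (i, j + 1, 2) = 0 := by
    intro i j
    simpa [Fin.sum_univ_three, HexVertex.star] using hdiv (i, j, true)
  -- Integrate the flow along each row of hexagons, across the edges of direction 2, starting from
  -- the left where it vanishes. The source condition then determines the other two directions.
  choose h h1 h2 using fun j => exists_primitive (fun k => f (k, j, 2)) (-N)
    (fun k hk => hN k j 2 (Or.inl hk))
  have e1 : ∀ i j, f (i, j, 1) = h j i - h (j + 1) i := by
    intro i j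
    have := Int.eq_const_of_forall_add_one
      (u := fun i => f (i, j, 1) - h j i + h (j + 1) i) ?_ i (-N - 1)
    · linarith [hN (-N - 1) j 1 (by omega), h2 j (-N - 1) (by omega),
        h2 (j + 1) (-N - 1) (by omega)]
    · intro i
      linarith [hb i j, hw i j, h1 j i, h1 (j + 1) i]
  have hrow : ∀ i j, (j < -N ∨ N < j) → h j i = 0 := by
    intro i j hj
    rw [Int.eq_const_of_forall_add_one (u := h j) ?_ i (-N), h2 j _ le_rfl]
    intro k
    linarith [h1 j k, hN k j 2 (by omega)]
  -- To the right of the box the height does not depend on the row, and it vanishes in rows far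
  -- away.
  have hcol : ∀ i j, N < i → h j i = 0 := by
    intro i j hi
    rw [Int.eq_const_of_forall_add_one (u := fun j => h j i) ?_ j (N + 1), hrow i _ (by omega)]
    intro k
    linarith [e1 i k, hN i k 1 (by omega)]
  refine ⟨fun c => h c.2 c.1, ?_, ?_⟩
  · refine finite_support_of_box (h := fun i j => h j i) (N := N) ?_
    rintro i j (hi | hi | hj)
    exacts [h2 j i hi.le, hcol i j hi, hrow i j hj]
  · rw [HexEdge.forall_iff]
    intro i j
    simp only [hexGrad, HexEdge.left, HexEdge.right]
    refine ⟨?_, ?_, ?_⟩ <;> linarith [hb i j, h1 j i, e1 i j]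

/-- A finitely supported function on the edges without circulation around the hexagons is the
difference of a finitely supported function on the vertices. -/
theorem exists_vertex_potential {z : HexEdge → ℤ} (hz : z.support.Finite)
    (hcirc : ∀ c : HexFace, ∑ d, z (c.leftEdge d) = ∑ d, z (c.rightEdge d)) :
    ∃ A : HexVertex → ℤ, A.support.Finite ∧ ∀ e, A e.black - A e.white = z e := by
  obtain ⟨N, hN⟩ := exists_box_of_finite_support hz
  have hc : ∀ i j, z (i - 1, j, 0) + z (i, j - 1, 1) + z (i, j, 2) =
      z (i, j - 1, 0) + z (i, j, 1) + z (i - 1, j, 2) := by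
    intro i j
    simpa [Fin.sum_univ_three, HexFace.leftEdge, HexFace.rightEdge] using hcirc (i, j)
  -- `B j` is the potential at the black vertices of row `j`; consecutive ones are joined through
  -- the white vertex `(k, j, true)`. The index `k + 1` shifts the starting point to `-N - 1`.
  choose B h1 h2 using fun j => exists_primitive (fun k => z (k + 1, j, 1) - z (k, j, 0)) (-N - 1)
    (fun k hk => by rw [hN (k + 1) j 1 (by omega), hN k j 0 (by omega)]; rfl)
  have e2 : ∀ i j, z (i, j, 2) = B j i - B (j - 1) i + z (i, j - 1, 0) := by
    intro i j
    have := Int.eq_const_of_forall_add_one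
      (u := fun i => z (i, j, 2) - B j i + B (j - 1) i - z (i, j - 1, 0)) ?_ i (-N - 1)
    · linarith [hN (-N - 1) j 2 (by omega), h2 j (-N - 1) (by omega),
        h2 (j - 1) (-N - 1) (by omega), hN (-N - 1) (j - 1) 0 (by omega)]
    · intro i
      have := hc (i + 1) j
      rw [add_sub_cancel_right] at this
      linarith [h1 j i, h1 (j - 1) i]
  have hrow : ∀ i j, (j < -N ∨ N < j) → B j i = 0 := by
    intro i j hj
    rw [Int.eq_const_of_forall_add_one (u := B j) ?_ i (-N - 1), h2 j _ le_rfl]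
    intro k
    linarith [h1 j k, hN (k + 1) j 1 (by omega), hN k j 0 (by omega)]
  have hcol : ∀ i j, N < i → B j i = 0 := by
    intro i j hi
    rw [Int.eq_const_of_forall_add_one (u := fun j => B j i) ?_ j (N + 1), hrow i _ (by omega)]
    intro k
    have := e2 i (k + 1)
    rw [add_sub_cancel_right] at this
    linarith [hN i (k + 1) 2 (by omega), hN i k 0 (by omega)]
  have hB : ∀ i j, (i < -N ∨ N < i ∨ j < -N ∨ N < j) → B j i = 0 := by
    rintro i j (hi | hi | hj)
    exacts [h2 j i (by omega), hcol i j hi, hrow i j hj]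
  have f1 := finite_support_of_box (h := fun i j => B j i) hB
  have f2 := finite_support_of_box (h := fun i j => B j i - z (i, j, 0)) (N := N)
    (fun i j h => by rw [hB i j h, hN i j 0 h]; rfl)
  refine ⟨fun v => if v.2.2 then B v.2.1 v.1 - z (v.1, v.2.1, 0) else B v.2.1 v.1, ?_, ?_⟩
  · refine ((f1.image fun c => (c.1, c.2, false)).union
      (f2.image fun c => (c.1, c.2, true))).subset ?_
    rintro ⟨i, j, _ | _⟩ hv
    · exact Or.inl ⟨(i, j), by simpa using hv, rfl⟩
    · exact Or.inr ⟨(i, j), by simpa using hv, rfl⟩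
  · rw [HexEdge.forall_iff]
    intro i j
    simp only [HexEdge.black, HexEdge.white]
    have h3 := h1 j (i - 1)
    rw [sub_add_cancel] at h3
    refine ⟨?_, ?_, ?_⟩
    · simp
    · simp only [Bool.false_eq_true, if_false, if_true]
      linarith
    · simp only [Bool.false_eq_true, if_false, if_true]
      linarith [e2 i j]

/-- Vertices of a given colour together with a direction correspond to edges. -/
def starEquiv (b : Bool) : (ℤ × ℤ) × Fin 3 ≃ HexEdge where
  toFun x := HexVertex.star (x.1.1, x.1.2, b) x.2
  invFun e := if b then ((e.white.1, e.white.2.1), e.dir) else ((e.black.1, e.black.2.1), e.dir)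
  left_inv := by
    rintro ⟨⟨i, j⟩, d⟩
    revert d
    rw [fin_three_forall]
    cases b <;> simp [HexVertex.star, HexEdge.white, HexEdge.black, HexEdge.dir]
  right_inv := by
    rw [Function.RightInverse, Function.LeftInverse, HexEdge.forall_iff]
    intro i j
    cases b <;> simp [HexVertex.star, HexEdge.white, HexEdge.black, HexEdge.dir]

/-- Every edge has exactly one end of colour `b`. Grouping the edges by this end factors out `A`,
and leaves star sums of `F` that vanish wherever `A` does not. -/
theorem finsum_end_mul_eq_zero (b : Bool) {A : HexVertex → ℤ} {F : HexEdge → ℤ}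
    (hA : A.support.Finite) (hF : ∀ v, A v ≠ 0 → ∑ d, F (v.star d) = 0)
    (E : HexEdge → HexVertex) (hE : ∀ i j d, E (HexVertex.star (i, j, b) d) = (i, j, b)) :
    (Function.support fun e => A (E e) * F e).Finite ∧ ∑ᶠ e, A (E e) * F e = 0 := by
  have hfin : (Function.support fun x : (ℤ × ℤ) × Fin 3 =>
      A (x.1.1, x.1.2, b) * F (HexVertex.star (x.1.1, x.1.2, b) x.2)).Finite := by
    refine ((hA.image fun v => (v.1, v.2.1)).prod Set.finite_univ).subset ?_
    rintro ⟨⟨i, j⟩, d⟩ hne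
    exact ⟨⟨(i, j, b), left_ne_zero_of_mul hne, rfl⟩, trivial⟩
  have heq : ∀ x, A (E (starEquiv b x)) * F (starEquiv b x) =
      A (x.1.1, x.1.2, b) * F (HexVertex.star (x.1.1, x.1.2, b) x.2) := by
    intro x
    simp only [starEquiv, Equiv.coe_fn_mk, hE]
  constructor
  · refine (hfin.image (starEquiv b)).subset ?_
    intro e he
    refine ⟨(starEquiv b).symm e, ?_, by simp⟩
    rw [Function.mem_support, ← heq]
    simpa using he
  · rw [← finsum_comp_equiv (starEquiv b)]
    simp only [heq]
    rw [finsum_curry _ hfin]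
    refine finsum_eq_zero_of_forall_eq_zero fun p => ?_
    rw [finsum_eq_sum_of_fintype]
    simp only
    rw [← Finset.mul_sum]
    by_cases h : A (p.1, p.2, b) = 0
    · rw [h, zero_mul]
    · rw [hF _ h, mul_zero]

/-- Summation by parts: a gradient is orthogonal to any `F` whose star sums vanish on the support of
the potential. The black and white ends contribute zero separately. -/
theorem finsum_sub_mul_eq_zero {A : HexVertex → ℤ} {F : HexEdge → ℤ}
    (hA : A.support.Finite) (hF : ∀ v, A v ≠ 0 → ∑ d, F (v.star d) = 0) :
    ∑ᶠ e : HexEdge, (A e.black - A e.white) * F e = 0 := by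
  obtain ⟨s1, h1⟩ := finsum_end_mul_eq_zero false hA hF HexEdge.black
    (fun i j d => by simp [HexVertex.star, HexEdge.black])
  obtain ⟨s2, h2⟩ := finsum_end_mul_eq_zero true hA hF HexEdge.white (fun i j => by
    rw [fin_three_forall]
    simp [HexVertex.star, HexEdge.white])
  simp only [sub_mul]
  rw [finsum_sub_distrib s1 s2, h1, h2, sub_zero]

/-! ### The interior of a cycle of the hexagonal lattice -/

section Interior

variable {u : HexVertex} {p : hexLattice.Walk u u}

theorem IsInteriorFace.adj {c : HexFace} (hc : IsInteriorFace p c) {e : HexEdge}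
    (he : e.left = c ∨ e.right = c) : (cycleWithInterior p).Adj e.black e.white :=
  Or.inr ⟨c, hc, HexFace.toSym2_mem_edges.2 he⟩

theorem IsInteriorFace.mem_verts {c : HexFace} (hc : IsInteriorFace p c) {v : HexVertex}
    (hv : v ∈ c.verts) : v ∈ (cycleWithInterior p).verts :=
  Or.inr ⟨c, hc, hv⟩

theorem IsInteriorFace.of_reachable {c d : HexFace} (hc : IsInteriorFace p c)
    (h : (faceGraphAvoiding p).Reachable d c) : IsInteriorFace p d :=
  hc.subset fun _ hx => h.symm.trans hx

/-- Two adjacent exterior hexagons share an edge that does not belong to the system. -/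
theorem exists_edge_of_faceGraphAvoiding_adj {c d : HexFace} (h : (faceGraphAvoiding p).Adj c d)
    (hc : ¬ IsInteriorFace p c) : ∃ e : HexEdge, ¬ (cycleWithInterior p).Adj e.black e.white ∧
      (e.left = c ∧ e.right = d ∨ e.left = d ∧ e.right = c) := by
  obtain ⟨hne, s, hsc, hsd, hsp⟩ := h
  obtain ⟨e, rfl⟩ := HexEdge.exists_toSym2_eq hsc.1
  have hd : ¬ IsInteriorFace p d := fun hd =>
    hc (hd.of_reachable (SimpleGraph.Adj.reachable ⟨hne, _, hsc, hsd, hsp⟩))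
  rw [HexFace.toSym2_mem_edges] at hsc hsd
  have hcd : e.left = c ∧ e.right = d ∨ e.left = d ∧ e.right = c := by
    rcases hsc with rfl | rfl <;> rcases hsd with rfl | rfl
    exacts [absurd rfl hne, Or.inl ⟨rfl, rfl⟩, Or.inr ⟨rfl, rfl⟩, absurd rfl hne]
  refine ⟨e, ?_, hcd⟩
  rintro (he | ⟨x, hx, he⟩)
  · exact hsp he
  · rcases HexFace.toSym2_mem_edges.1 he with rfl | rfl <;> rcases hcd with ⟨h1, h2⟩ | ⟨h1, h2⟩
    exacts [hc (h1 ▸ hx), hd (h1 ▸ hx), hd (h2 ▸ hx), hc (h2 ▸ hx)]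

/-- A finitely supported function that is constant on connected sets of exterior hexagons vanishes
at the exterior hexagons. -/
theorem eq_zero_of_not_isInteriorFace {φ : HexFace → ℤ} (hfin : φ.support.Finite)
    (hφ : ∀ c d, ¬ IsInteriorFace p c → ¬ IsInteriorFace p d → (faceGraphAvoiding p).Adj c d →
      φ c = φ d) {c : HexFace} (hc : ¬ IsInteriorFace p c) : φ c = 0 := by
  by_contra hne
  -- A nonzero value would spread over the whole component of `c`, which is infinite.
  have key : ∀ d, (faceGraphAvoiding p).Reachable c d → φ c = φ d := by
    rintro d ⟨w⟩
    induction w with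
    | nil => rfl
    | cons hadj w ih =>
      have hb := fun hb => hc (IsInteriorFace.of_reachable hb hadj.reachable)
      rw [hφ _ _ hc hb hadj]
      exact ih hb (by rwa [← hφ _ _ hc hb hadj])
  exact hc (hfin.subset fun d hd => by
    rw [Function.mem_support, ← key d hd]
    exact hne)

/-- Neighbouring exterior hexagons share an edge outside the system; no flow crosses it, so their
heights agree. -/
theorem height_eq_zero {h : HexFace → ℤ} (hfin : h.support.Finite)
    (hh : ∀ e : HexEdge, ¬ (cycleWithInterior p).Adj e.black e.white → hexGrad h e = 0)
    {c : HexFace} (hc : ¬ IsInteriorFace p c) : h c = 0 := by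
  refine eq_zero_of_not_isInteriorFace hfin (fun c d hc _ hadj => ?_) hc
  obtain ⟨e, he, ⟨rfl, rfl⟩ | ⟨rfl, rfl⟩⟩ := exists_edge_of_faceGraphAvoiding_adj hadj hc
  · exact (sub_eq_zero.1 (hh e he)).symm
  · exact sub_eq_zero.1 (hh e he)

theorem HexVertex.exists_mem_verts (v : HexVertex) : ∃ c : HexFace, v ∈ c.verts :=
  ⟨(v.star 0).left, HexFace.mem_verts_iff_left.2 ⟨0, rfl⟩⟩

/-- A function on the vertices that is constant along the edges of a hexagon is constant on its
vertices. -/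
theorem HexFace.eq_of_forall_edge {α : Type*} {A : HexVertex → α} {c : HexFace}
    (hA : ∀ e : HexEdge, e.left = c ∨ e.right = c → A e.black = A e.white) {v : HexVertex}
    (hv : v ∈ c.verts) : A v = A (c.1, c.2, false) := by
  obtain ⟨a, b⟩ := c
  have h1 := hA (a, b, 2) (Or.inl rfl)
  have h2 := hA (a, b, 1) (Or.inr rfl)
  have h3 := hA (a - 1, b, 0) (Or.inl (by simp [HexEdge.left]))
  have h4 := hA (a, b - 1, 0) (Or.inr (by simp [HexEdge.right]))
  have h5 := hA (a - 1, b, 2) (Or.inr (by simp [HexEdge.right]))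
  simp only [HexEdge.black, HexEdge.white] at h1 h2 h3 h4 h5
  obtain ⟨i, j, _ | _⟩ := v
  · simp only [HexFace.mem_verts, HexVertex.faces, Set.mem_insert_iff, Set.mem_singleton_iff,
      Prod.mk.injEq] at hv
    rcases hv with ⟨rfl, rfl⟩ | ⟨rfl, rfl⟩ | ⟨rfl, rfl⟩
    · rfl
    · rw [add_sub_cancel_right] at *
      exact h3.trans h2.symm
    · rw [add_sub_cancel_right] at *
      exact h4.trans h1.symm
  · simp only [HexFace.mem_verts, HexVertex.faces, Set.mem_insert_iff, Set.mem_singleton_iff,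
      Prod.mk.injEq] at hv
    rcases hv with ⟨rfl, rfl⟩ | ⟨rfl, rfl⟩ | ⟨rfl, rfl⟩
    · simp only [add_sub_cancel_right] at *
      exact h2.symm
    · simp only [add_sub_cancel_right] at *
      exact h1.symm
    · simp only [add_sub_cancel_right] at *
      exact h5.symm.trans (h3.trans h2.symm)

/-- `A` is constant around each exterior hexagon, and adjacent exterior hexagons share vertices. It
thus descends to a function on exterior hexagons, to which `eq_zero_of_not_isInteriorFace` applies.
-/
theorem vertex_potential_eq_zero {A : HexVertex → ℤ} (hfin : A.support.Finite)
    (hA : ∀ e : HexEdge, ¬ IsInteriorFace p e.left ∨ ¬ IsInteriorFace p e.right →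
      A e.black = A e.white) {v : HexVertex} (hv : v ∉ (cycleWithInterior p).verts) : A v = 0 := by
  obtain ⟨c, hc⟩ := v.exists_mem_verts
  have hext : ¬ IsInteriorFace p c := fun hi => hv (hi.mem_verts hc)
  have hconst : ∀ d, ¬ IsInteriorFace p d → ∀ v ∈ d.verts, A v = A (d.1, d.2, false) :=
    fun d hd v hvd => HexFace.eq_of_forall_edge (fun e he => hA e (by
      rcases he with rfl | rfl
      exacts [Or.inl hd, Or.inr hd])) hvd
  rw [hconst c hext v hc]
  refine eq_zero_of_not_isInteriorFace (p := p) (φ := fun d => A (d.1, d.2, false)) ?_ ?_ hext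
  · refine Set.Finite.preimage (f := fun d : HexFace => ((d.1, d.2, false) : HexVertex)) ?_ hfin
    rintro ⟨a, b⟩ _ ⟨a', b'⟩ _ h
    simpa using h
  · intro c d hc hd hadj
    obtain ⟨e, -, he⟩ := exists_edge_of_faceGraphAvoiding_adj hadj hc
    have hm : ∀ x : HexFace, e.left = x ∨ e.right = x → e.black ∈ x.verts := fun x hx =>
      (HexFace.toSym2_mem_edges.2 hx).2 _ (Sym2.mem_mk_left _ _)
    rw [← hconst c hc e.black (hm c (by tauto)), ← hconst d hd e.black (hm d (by tauto))]

end Interior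

/-! ### Perfect matchings as 0-1 functions on the edges -/

/-- The function `m` is the indicator function of a perfect matching of `H`. -/
structure IsMatchingIndicator (H : hexLattice.Subgraph) (m : HexEdge → ℤ) : Prop where
  zero_or_one : ∀ e, m e = 0 ∨ m e = 1
  adj : ∀ e, m e ≠ 0 → H.Adj e.black e.white
  sum_star : ∀ v ∈ H.verts, ∑ d, m (v.star d) = 1

/-- The hexagon `c` is a proper sextet of the perfect matching `m`: it belongs to `H`, and the
edges with `c` on the right belong to `m`. -/
def IsProperSextet (H : hexLattice.Subgraph) (m : HexEdge → ℤ) (c : HexFace) : Prop :=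
  ∀ e : HexEdge, (e.left = c → H.Adj e.black e.white) ∧ (e.right = c → m e = 1)

namespace IsMatchingIndicator

variable {H : hexLattice.Subgraph} {m : HexEdge → ℤ}

theorem nonneg (hm : IsMatchingIndicator H m) (e : HexEdge) : 0 ≤ m e := by
  rcases hm.zero_or_one e with h | h <;> omega

theorem star_mem {v : HexVertex} {d : Fin 3} (h : H.Adj (v.star d).black (v.star d).white) :
    v ∈ H.verts := by
  rcases v.star_end d with h' | h'
  · rw [← h']; exact h.fst_mem
  · rw [← h']; exact h.snd_mem

theorem star_unique (hm : IsMatchingIndicator H m) {v : HexVertex} {d d' : Fin 3}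
    (h : m (v.star d) = 1) (h' : m (v.star d') = 1) : d = d' := by
  by_contra hne
  have hv : v ∈ H.verts := star_mem (d := d) (hm.adj _ (by omega))
  have h1 := hm.sum_star v hv
  rw [← Finset.add_sum_erase _ _ (Finset.mem_univ d),
    ← Finset.add_sum_erase _ _ (Finset.mem_erase.2 ⟨Ne.symm hne, Finset.mem_univ d'⟩)] at h1
  have h2 : 0 ≤ ∑ x ∈ (Finset.univ.erase d).erase d', m (v.star x) :=
    Finset.sum_nonneg fun x _ => hm.nonneg _
  omega

theorem exists_star (hm : IsMatchingIndicator H m) {v : HexVertex} (hv : v ∈ H.verts) :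
    ∃ d, m (v.star d) = 1 := by
  by_contra! hcon
  have h1 := hm.sum_star v hv
  rw [Finset.sum_eq_zero fun d _ => (hm.zero_or_one _).resolve_right (hcon d)] at h1
  omega

/-- A hexagon on the left of an edge of the matching is no proper sextet. -/
theorem eq_zero_of_left (hm : IsMatchingIndicator H m) {e : HexEdge}
    (hc : IsProperSextet H m e.left) : m e = 0 := by
  refine (hm.zero_or_one e).resolve_right fun h => ?_
  have hv : e.black ∈ e.left.verts := HexFace.mem_verts_iff_left.2 ⟨e.dir, rfl⟩
  obtain ⟨d, hd⟩ := HexFace.mem_verts_iff_right.1 hv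
  have := hm.star_unique ((hc _).2 hd) (v := e.black) (d' := e.dir) h
  subst this
  exact e.left_ne_right hd.symm

end IsMatchingIndicator

open Classical in
theorem hexGrad_sub_single (h : HexFace → ℤ) (c : HexFace) (e : HexEdge) :
    hexGrad (h - Pi.single c 1) e =
      hexGrad h e + (if e.left = c then 1 else 0) - (if e.right = c then 1 else 0) := by
  simp only [hexGrad, Pi.sub_apply, Pi.single_apply]
  ring

/-- The height functions of the perfect matchings of `H` relative to `m₀`. -/
def heightLattice (H : hexLattice.Subgraph) (m₀ : HexEdge → ℤ) : Sublattice (HexFace → ℤ) where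
  carrier := {h | h.support.Finite ∧ IsMatchingIndicator H (m₀ + hexGrad h)}
  supClosed' := by
    rintro h ⟨hf, hm⟩ h' ⟨hf', hm'⟩
    refine ⟨(hf.union hf').subset ?_, ?_, ?_, ?_⟩
    · exact Function.support_sup h h'
    -- The gradient of a pointwise maximum lies between the two gradients, so the resulting value
    -- stays in {0, 1}, and stays 0 where both matchings vanish. The same holds for minima.
    · intro e
      have h1 := hm.zero_or_one e
      have h2 := hm'.zero_or_one e
      simp only [Pi.add_apply, hexGrad, Pi.sup_apply] at h1 h2 ⊢
      omega
    · intro e he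
      by_contra hadj
      have h1 := not_imp_comm.1 (hm.adj e) hadj
      have h2 := not_imp_comm.1 (hm'.adj e) hadj
      simp only [Pi.add_apply, hexGrad, Pi.sup_apply] at h1 h2 he
      omega
    · intro v hv
      have h1 := hm.sum_star v hv
      simp only [Pi.add_apply, Finset.sum_add_distrib, sum_star_hexGrad] at h1 ⊢
      exact h1
  infClosed' := by
    rintro h ⟨hf, hm⟩ h' ⟨hf', hm'⟩
    refine ⟨(hf.union hf').subset ?_, ?_, ?_, ?_⟩
    · exact Function.support_inf h h'
    · intro e
      have h1 := hm.zero_or_one e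
      have h2 := hm'.zero_or_one e
      simp only [Pi.add_apply, hexGrad, Pi.inf_apply] at h1 h2 ⊢
      omega
    · intro e he
      by_contra hadj
      have h1 := not_imp_comm.1 (hm.adj e) hadj
      have h2 := not_imp_comm.1 (hm'.adj e) hadj
      simp only [Pi.add_apply, hexGrad, Pi.inf_apply] at h1 h2 he
      omega
    · intro v hv
      have h1 := hm.sum_star v hv
      simp only [Pi.add_apply, Finset.sum_add_distrib, sum_star_hexGrad] at h1 ⊢
      exact h1

section HeightLattice

variable {H : hexLattice.Subgraph} {m₀ : HexEdge → ℤ}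

theorem sum_star_add_hexGrad (h : HexFace → ℤ) (v : HexVertex) :
    ∑ d, (m₀ + hexGrad h) (v.star d) = ∑ d, m₀ (v.star d) := by
  simp only [Pi.add_apply, Finset.sum_add_distrib, sum_star_hexGrad, add_zero]

/-- Proper sextets are the hexagons at which the height can be lowered. -/
theorem sub_single_mem_iff {h : HexFace → ℤ} (hh : h ∈ heightLattice H m₀) (c : HexFace) :
    h - Pi.single c 1 ∈ heightLattice H m₀ ↔ IsProperSextet H (m₀ + hexGrad h) c := by
  classical
  have hgrad : ∀ e, (m₀ + hexGrad (h - Pi.single c 1)) e = (m₀ + hexGrad h) e +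
      (if e.left = c then 1 else 0) - (if e.right = c then 1 else 0) := by
    intro e
    simp only [Pi.add_apply, hexGrad_sub_single]
    ring
  constructor
  · intro h' e
    have h1 := hgrad e
    have h2 := h'.2.zero_or_one e
    have h3 := hh.2.zero_or_one e
    have h4 := e.left_ne_right
    constructor
    · rintro rfl
      apply h'.2.adj
      rw [if_pos rfl, if_neg (Ne.symm h4)] at h1
      omega
    · rintro rfl
      rw [if_pos rfl, if_neg h4] at h1
      omega
  · intro hc
    refine ⟨(hh.1.union (Set.finite_singleton c)).subset ?_, ?_, ?_, ?_⟩
    · intro x hx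
      by_contra hx'
      simp only [Set.mem_union, Function.mem_support, not_or, not_not, Set.mem_singleton_iff] at hx'
      exact hx (by simp [hx'.1, hx'.2])
    · intro e
      rw [hgrad]
      have h3 := hh.2.zero_or_one e
      have h4 := e.left_ne_right
      by_cases hl : e.left = c
      · subst hl
        rw [hh.2.eq_zero_of_left hc, if_pos rfl, if_neg (Ne.symm h4)]
        right; rfl
      · by_cases hr : e.right = c
        · rw [(hc e).2 hr, if_neg hl, if_pos hr]
          left; rfl
        · rw [if_neg hl, if_neg hr]
          simpa using h3
    · intro e he
      by_cases hl : e.left = c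
      · exact (hc e).1 hl
      · refine hh.2.adj e fun h0 => he ?_
        have h4 : e.right ≠ c := fun hr => by
          have := (hc e).2 hr
          omega
        rw [hgrad, h0, if_neg hl, if_neg h4]
        rfl
    · intro v hv
      rw [sum_star_add_hexGrad, ← sum_star_add_hexGrad h]
      exact hh.2.sum_star v hv

end HeightLattice

/-- By pigeonhole an orbit in a finite set repeats a value. This produces both the closed walk of
hexagons in the descent and the alternating cycle that gives a second matching. -/
theorem exists_minimalPeriod_pos {α : Type*} {D : Set α} (hD : D.Finite) {f : α → α}
    (hf : Set.MapsTo f D D) {x : α} (hx : x ∈ D) :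
    ∃ y ∈ D, 0 < Function.minimalPeriod f y := by
  have hmem : ∀ n, f^[n] x ∈ D := fun n => hf.iterate n hx
  obtain ⟨a, b, hab, h⟩ : ∃ a b, a < b ∧ f^[a] x = f^[b] x := by
    obtain ⟨a, -, b, -, hne, h⟩ := Set.infinite_univ.exists_ne_map_eq_of_mapsTo
      (f := fun n : ℕ => f^[n] x) (fun n _ => hmem n) hD
    rcases lt_or_gt_of_ne hne with hlt | hlt
    exacts [⟨a, b, hlt, h⟩, ⟨b, a, hlt, h.symm⟩]
  refine ⟨f^[a] x, hmem a, Function.IsPeriodicPt.minimalPeriod_pos (n := b - a) (by omega) ?_⟩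
  rw [Function.IsPeriodicPt, Function.IsFixedPt, ← Function.iterate_add_apply,
    Nat.sub_add_cancel hab.le, h]

/-! ### Descent from a matching to a smaller one by a rotation -/

section Descent

variable {u : HexVertex} {p : hexLattice.Walk u u}

/-- In a set of interior hexagons one cannot always step to a further hexagon of the set across an
unmatched edge, from right to left. -/
theorem exists_forall_matched {m : HexEdge → ℤ}
    (hm : IsMatchingIndicator (cycleWithInterior p) m) {D : Set HexFace} (hD : D.Finite)
    (hne : D.Nonempty) (hint : ∀ c ∈ D, IsInteriorFace p c) :
    ∃ c ∈ D, ∀ e : HexEdge, e.right = c → e.left ∈ D → m e = 1 := by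
  classical
  by_contra! hcon
  have hcon' : ∀ c, ∃ e : HexEdge, c ∈ D → e.right = c ∧ e.left ∈ D ∧ m e = 0 := by
    intro c
    by_cases hc : c ∈ D
    · obtain ⟨e, h1, h2, h3⟩ := hcon c hc
      exact ⟨e, fun _ => ⟨h1, h2, (hm.zero_or_one e).resolve_right h3⟩⟩
    · exact ⟨(0, 0, 0), fun h => absurd h hc⟩
  choose E hE using hcon'
  let f : HexFace → HexFace := fun c => (E c).left
  have hf : Set.MapsTo f D D := fun c hc => (hE c hc).2.1
  obtain ⟨x, hx⟩ := hne
  obtain ⟨y, hy, hpos⟩ := exists_minimalPeriod_pos hD hf hx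
  set n := Function.minimalPeriod f y with hn
  have hmem : ∀ k, f^[k] y ∈ D := fun k => hf.iterate k hy
  -- `z e` is the number of times the closed walk of hexagons crosses `e`, always from right to
  -- left.
  let z : HexEdge → ℤ := fun e => ∑ k ∈ Finset.range n, if E (f^[k] y) = e then 1 else 0
  have hz : ∀ e, z e ≠ 0 → ∃ k ∈ Finset.range n, E (f^[k] y) = e := by
    intro e he
    obtain ⟨k, hk, hk'⟩ := Finset.exists_ne_zero_of_sum_ne_zero he
    exact ⟨k, hk, by_contra fun h => hk' (if_neg h)⟩
  have hzfin : z.support.Finite := by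
    refine ((Finset.range n).image fun k => E (f^[k] y)).finite_toSet.subset fun e he => ?_
    obtain ⟨k, hk, rfl⟩ := hz e he
    exact Finset.mem_coe.2 (Finset.mem_image_of_mem _ hk)
  have hright : ∀ c : HexFace, ∑ d, z (c.rightEdge d) =
      ∑ k ∈ Finset.range n, if f^[k] y = c then 1 else 0 := by
    intro c
    simp only [z]
    rw [Finset.sum_comm]
    refine Finset.sum_congr rfl fun k _ => ?_
    have hk := (hE _ (hmem k)).1
    by_cases h : f^[k] y = c
    · rw [if_pos h, Finset.sum_eq_single (E (f^[k] y)).dir]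
      · rw [if_pos]
        have h1 := (E (f^[k] y)).rightEdge_right
        rw [hk, h] at h1
        rw [h, h1]
      · intro d _ hd
        rw [if_neg]
        intro h'
        exact hd (by rw [h', HexFace.dir_rightEdge])
      · simp
    · rw [if_neg h]
      refine Finset.sum_eq_zero fun d _ => if_neg fun h' => h ?_
      rw [← hk, h', HexFace.right_rightEdge]
  have hleft : ∀ c : HexFace, ∑ d, z (c.leftEdge d) =
      ∑ k ∈ Finset.range n, if f^[k + 1] y = c then 1 else 0 := by
    intro c
    simp only [z]
    rw [Finset.sum_comm]
    refine Finset.sum_congr rfl fun k _ => ?_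
    have hk : (E (f^[k] y)).left = f^[k + 1] y := by
      rw [Function.iterate_succ_apply']
    by_cases h : f^[k + 1] y = c
    · rw [if_pos h, Finset.sum_eq_single (E (f^[k] y)).dir]
      · rw [if_pos]
        rw [← h, ← hk, HexEdge.leftEdge_left]
      · intro d _ hd
        rw [if_neg]
        intro h'
        exact hd (by rw [h', HexFace.dir_leftEdge])
      · simp
    · rw [if_neg h]
      refine Finset.sum_eq_zero fun d _ => if_neg fun h' => h ?_
      rw [← hk, h', HexFace.left_leftEdge]
  -- The closed walk enters each hexagon as often as it leaves it. Hence `z` has a potential `A`,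
  -- the winding number of the walk around the vertices.
  have hcirc : ∀ c : HexFace, ∑ d, z (c.leftEdge d) = ∑ d, z (c.rightEdge d) := by
    intro c
    rw [hleft, hright]
    have h1 := Finset.sum_range_succ' (fun k => if f^[k] y = c then (1 : ℤ) else 0) n
    have h2 := Finset.sum_range_succ (fun k => if f^[k] y = c then (1 : ℤ) else 0) n
    rw [h2, hn, Function.iterate_minimalPeriod] at h1
    rw [Function.iterate_zero, id] at h1
    linarith
  obtain ⟨A, hAfin, hA⟩ := exists_vertex_potential hzfin hcirc
  have hAH : ∀ v, A v ≠ 0 → v ∈ (cycleWithInterior p).verts := by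
    intro v hv
    by_contra hvH
    refine hv (vertex_potential_eq_zero hAfin (fun e he => ?_) hvH)
    rw [← sub_eq_zero, hA]
    by_contra hze
    obtain ⟨k, -, rfl⟩ := hz e hze
    have h1 := hE _ (hmem k)
    rw [h1.1] at he
    rcases he with he | he
    exacts [he (hint _ h1.2.1), he (hint _ (hmem k))]
  -- Each vertex of the system has one matched edge among three lattice edges, so the weight `3 * m
  -- e - 1` sums to zero over its star. As `m = 0` on every crossed edge, the pairing with `z`
  -- equals minus the length of the walk, which is not zero.
  have hstokes := finsum_sub_mul_eq_zero (F := fun e => 3 * m e - 1) hAfin (fun v hv => by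
    rw [Finset.sum_sub_distrib, ← Finset.mul_sum, hm.sum_star v (hAH v hv)]
    rfl)
  simp only [hA] at hstokes
  rw [finsum_eq_sum_of_support_subset (s := (Finset.range n).image fun k => E (f^[k] y))] at hstokes
  · have hle : ∑ e ∈ (Finset.range n).image fun k => E (f^[k] y), z e * (3 * m e - 1) =
        - ∑ e ∈ (Finset.range n).image fun k => E (f^[k] y), z e := by
      rw [← Finset.sum_neg_distrib]
      refine Finset.sum_congr rfl fun e he => ?_
      obtain ⟨k, -, rfl⟩ := Finset.mem_image.1 he
      rw [(hE _ (hmem k)).2.2]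
      ring
    have hznn : ∀ e, 0 ≤ z e := fun e => Finset.sum_nonneg fun k _ => by split_ifs <;> norm_num
    have hE0 : E y ∈ (Finset.range n).image fun k => E (f^[k] y) :=
      Finset.mem_image.2 ⟨0, Finset.mem_range.2 hpos, rfl⟩
    have h1 : 1 ≤ z (E y) := by
      have := Finset.single_le_sum (f := fun k => if E (f^[k] y) = E y then (1 : ℤ) else 0)
        (s := Finset.range n) (fun k _ => by split_ifs <;> norm_num) (Finset.mem_range.2 hpos)
      rwa [Function.iterate_zero, id, if_pos rfl] at this
    have h2 := Finset.single_le_sum (f := z) (fun e _ => hznn e) hE0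
    rw [hle] at hstokes
    omega
  · intro e he
    obtain ⟨k, hk, rfl⟩ := hz e (left_ne_zero_of_mul he)
    exact Finset.mem_coe.2 (Finset.mem_image_of_mem _ hk)

/-- Both matchings vanish off the system, so the difference of the heights has no gradient there. -/
theorem isInteriorFace_of_height_ne {m₀ : HexEdge → ℤ} {h h' : HexFace → ℤ}
    (hh : h ∈ heightLattice (cycleWithInterior p) m₀)
    (hh' : h' ∈ heightLattice (cycleWithInterior p) m₀) {c : HexFace} (hc : h c ≠ h' c) :
    IsInteriorFace p c := by
  by_contra hext
  refine hc (sub_eq_zero.1 (height_eq_zero (h := h - h') (p := p) ?_ (fun e he => ?_) hext))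
  · exact (hh.1.union hh'.1).subset (Function.support_sub h h')
  · have h1 := not_imp_comm.1 (hh.2.adj e) he
    have h2 := not_imp_comm.1 (hh'.2.adj e) he
    simp only [Pi.add_apply, hexGrad, Pi.sub_apply] at h1 h2 ⊢
    omega

/-- Between two comparable matchings there is a rotation of a proper sextet. -/
theorem exists_sub_single_mem {m₀ : HexEdge → ℤ} {h h' : HexFace → ℤ}
    (hh : h ∈ heightLattice (cycleWithInterior p) m₀)
    (hh' : h' ∈ heightLattice (cycleWithInterior p) m₀) (hlt : h < h') :
    ∃ c, h c < h' c ∧ h' - Pi.single c 1 ∈ heightLattice (cycleWithInterior p) m₀ := by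
  obtain ⟨hle, x, hx⟩ := Pi.lt_def.1 hlt
  have hfin : {c | h c < h' c}.Finite := by
    refine (hh.1.union hh'.1).subset fun c hc => ?_
    by_contra hcon
    simp only [Set.mem_union, Function.mem_support, not_or, not_not] at hcon
    rw [Set.mem_ofPred_eq, hcon.1, hcon.2] at hc
    exact lt_irrefl _ hc
  have hint : ∀ c ∈ {c | h c < h' c}, IsInteriorFace p c := fun c hc =>
    isInteriorFace_of_height_ne hh hh' (ne_of_lt hc)
  obtain ⟨c, hc, hce⟩ := exists_forall_matched hh'.2 hfin ⟨x, hx⟩ hint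
  refine ⟨c, hc, (sub_single_mem_iff hh' c).2 fun e => ⟨?_, ?_⟩⟩
  · intro he
    exact (hint c hc).adj (Or.inl he)
  · intro he
    by_cases hl : h e.left < h' e.left
    · exact hce e he hl
    · have h1 := hh.2.zero_or_one e
      have h2 := hh'.2.zero_or_one e
      have h3 : h c < h' c := hc
      subst he
      simp only [Pi.add_apply, hexGrad] at h1 h2 ⊢
      omega

end Descent

/-! ### The lattice of perfect matchings -/

/-- Such a function is constant along each infinite row. This makes the height of a matching unique.
-/
theorem eq_zero_of_hexGrad_eq_zero {k : HexFace → ℤ} (hk : k.support.Finite)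
    (h : ∀ e, hexGrad k e = 0) : k = 0 := by
  by_contra hne
  obtain ⟨⟨i, j⟩, hij⟩ := Function.ne_iff.1 hne
  have hconst : ∀ l, k (l, j) = k (i, j) := fun l =>
    Int.eq_const_of_forall_add_one (u := fun l => k (l, j))
      (fun l => sub_eq_zero.1 (h (l, j, 2))) l i
  refine Set.infinite_range_of_injective (f := fun l : ℤ => ((l, j) : HexFace))
    (fun a b hab => (Prod.mk.inj hab).1) (hk.subset ?_)
  rintro _ ⟨l, rfl⟩
  rw [Function.mem_support, hconst]
  exact hij

section Finite

variable {H : hexLattice.Subgraph}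

theorem finite_setOf_edge (hH : H.verts.Finite) :
    {e : HexEdge | H.Adj e.black e.white}.Finite := by
  refine Set.Finite.subset ((hH.prod (Set.finite_univ (α := Fin 3))).image
    fun x => HexVertex.star x.1 x.2) ?_
  intro e he
  exact ⟨(e.black, e.dir), ⟨he.fst_mem, trivial⟩, rfl⟩

theorem IsMatchingIndicator.finite_support (hH : H.verts.Finite) {m : HexEdge → ℤ}
    (hm : IsMatchingIndicator H m) : m.support.Finite :=
  (finite_setOf_edge hH).subset fun e he => hm.adj e he

theorem finite_setOf_isMatchingIndicator (hH : H.verts.Finite) :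
    {m | IsMatchingIndicator H m}.Finite := by
  refine Set.Finite.of_finite_image (f := Function.support) ?_ ?_
  · refine (finite_setOf_edge hH).finite_subsets.subset ?_
    rintro _ ⟨m, hm, rfl⟩
    exact fun e he => hm.adj e he
  · intro m hm m' hm' h
    funext e
    have h0 : m e ≠ 0 ↔ m' e ≠ 0 := by
      simpa using congrArg (e ∈ ·) h
    have h1 := hm.zero_or_one e
    have h2 := hm'.zero_or_one e
    omega

variable {m₀ : HexEdge → ℤ}

/-- Two perfect matchings have equal star sums at every vertex, namely 1 in `H` and 0 outside, so
their difference is a flow without sources. -/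
theorem exists_height (hH : H.verts.Finite) (hm₀ : IsMatchingIndicator H m₀) {m : HexEdge → ℤ}
    (hm : IsMatchingIndicator H m) : ∃ h ∈ heightLattice H m₀, m₀ + hexGrad h = m := by
  obtain ⟨h, hfin, hh⟩ := exists_hexGrad_eq (f := m - m₀)
    (((hm.finite_support hH).union (hm₀.finite_support hH)).subset (Function.support_sub m m₀))
    (fun v => by
      simp only [Pi.sub_apply, Finset.sum_sub_distrib]
      by_cases hv : v ∈ H.verts
      · rw [hm.sum_star v hv, hm₀.sum_star v hv, sub_self]
      · have hzero : ∀ m, IsMatchingIndicator H m → ∀ d, m (v.star d) = 0 := fun m hm d => by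
          by_contra hne
          exact hv (IsMatchingIndicator.star_mem (hm.adj _ hne))
        simp [hzero m hm, hzero m₀ hm₀])
  have heq : m₀ + hexGrad h = m := by
    funext e
    simp [hh]
  exact ⟨h, ⟨hfin, heq ▸ hm⟩, heq⟩

theorem height_injective {h h' : HexFace → ℤ} (hh : h ∈ heightLattice H m₀)
    (hh' : h' ∈ heightLattice H m₀) (heq : m₀ + hexGrad h = m₀ + hexGrad h') : h = h' := by
  rw [← sub_eq_zero]
  refine eq_zero_of_hexGrad_eq_zero ((hh.1.union hh'.1).subset (Function.support_sub h h')) ?_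
  intro e
  have := congrFun heq e
  simp only [Pi.add_apply, hexGrad, Pi.sub_apply] at this ⊢
  linarith

theorem finite_heightLattice (hH : H.verts.Finite) : Finite (heightLattice H m₀) := by
  have := (finite_setOf_isMatchingIndicator hH).to_subtype
  refine Finite.of_injective (β := {m | IsMatchingIndicator H m})
    (fun h => ⟨m₀ + hexGrad h.1, h.2.2⟩) fun h h' heq => ?_
  exact Subtype.ext (height_injective h.2 h'.2 (Subtype.mk.inj heq))

end Finite

/-! ### Lower covers as proper sextets, and a second perfect matching -/

section Cover

variable {u : HexVertex} {p : hexLattice.Walk u u} {m₀ : HexEdge → ℤ}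

/-- The lower covers of a height function correspond to the proper sextets. -/
theorem ncard_covBy_heightLattice (a : heightLattice (cycleWithInterior p) m₀) :
    {b | b ⋖ a}.ncard =
      {c | IsProperSextet (cycleWithInterior p) (m₀ + hexGrad a.1) c}.ncard := by
  classical
  have hlt : ∀ c : HexFace, a.1 - Pi.single c 1 < a.1 := fun c => by
    refine Pi.lt_def.2 ⟨fun x => ?_, c, ?_⟩
    · simp only [Pi.sub_apply, Pi.single_apply]
      split_ifs <;> omega
    · simp
  symm
  refine Set.ncard_congr (fun c hc => ⟨a.1 - Pi.single c 1, (sub_single_mem_iff a.2 c).2 hc⟩)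
    ?_ ?_ ?_
  · intro c hc
    refine ⟨hlt c, fun b hb hba => ?_⟩
    obtain ⟨h1, x, hx⟩ := Pi.lt_def.1 (show a.1 - Pi.single c 1 < b.1 from hb)
    obtain ⟨h2, y, hy⟩ := Pi.lt_def.1 (show b.1 < a.1 from hba)
    simp only [Pi.sub_apply, Pi.single_apply] at hx
    have h3 := h1 y
    simp only [Pi.sub_apply, Pi.single_apply] at h3
    have h4 : b.1 x ≤ a.1 x := h2 x
    have hxc : x = c := by
      by_contra hne
      rw [if_neg hne] at hx
      omega
    have hyc : y = c := by
      by_contra hne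
      rw [if_neg hne] at h3
      omega
    subst hxc hyc
    rw [if_pos rfl] at hx
    omega
  · intro c d hc hd h
    have := congrFun (Subtype.mk.inj h) c
    simp only [Pi.sub_apply, Pi.single_eq_same, Pi.single_apply] at this
    by_contra hne
    rw [if_neg hne] at this
    omega
  · intro b hb
    -- The descent yields a rotation of `a` that stays above `b`; as `b` is a lower cover, the two
    -- coincide.
    obtain ⟨c, hc, hmem⟩ := exists_sub_single_mem b.2 a.2 hb.lt
    refine ⟨c, (sub_single_mem_iff a.2 c).1 hmem, ?_⟩
    have hle : b ≤ ⟨a.1 - Pi.single c 1, hmem⟩ := by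
      intro x
      have := hb.lt.le x
      simp only [Pi.sub_apply, Pi.single_apply]
      split_ifs with hx
      · subst hx
        omega
      · rwa [sub_zero]
    exact (hle.eq_of_not_lt fun h => hb.2 h (hlt c)).symm

/-- The cover polynomial of the lattice of perfect matchings counts proper sextets. -/
theorem coverPoly_heightLattice (hfin : (cycleWithInterior p).verts.Finite)
    (hm₀ : IsMatchingIndicator (cycleWithInterior p) m₀)
    [Fintype (heightLattice (cycleWithInterior p) m₀)] :
    coverPoly (heightLattice (cycleWithInterior p) m₀) =
      ∑ m ∈ (finite_setOf_isMatchingIndicator hfin).toFinset,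
        X ^ {c | IsProperSextet (cycleWithInterior p) m c}.ncard := by
  unfold coverPoly
  refine Finset.sum_bij (fun a _ => m₀ + hexGrad a.1) ?_ ?_ ?_ ?_
  · intro a _
    simpa using a.2.2
  · intro a _ b _ h
    exact Subtype.ext (height_injective a.2 b.2 h)
  · intro m hm
    obtain ⟨h, hh, heq⟩ := exists_height hfin hm₀ (by simpa using hm)
    exact ⟨⟨h, hh⟩, Finset.mem_univ _, heq⟩
  · intro a _
    rw [ncard_covBy_heightLattice]

theorem exists_star_of_adj {H : hexLattice.Subgraph} {v w : HexVertex} (h : H.Adj v w) :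
    ∃ d, H.Adj (v.star d).black (v.star d).white ∧ (v.star d).toSym2 = s(v, w) := by
  obtain ⟨e, ⟨rfl, rfl⟩ | ⟨rfl, rfl⟩⟩ := hexLattice_adj_iff.1 h.adj_sub
  · exact ⟨e.dir, h, rfl⟩
  · refine ⟨e.dir, ?_⟩
    rw [e.star_white]
    exact ⟨h.symm, Sym2.eq_swap⟩

/-- Every vertex of a hexagonal system lies on at least two edges. -/
theorem exists_two_edges (hp : p.IsCycle) {v : HexVertex}
    (hv : v ∈ (cycleWithInterior p).verts) :
    ∃ d d', d ≠ d' ∧ (cycleWithInterior p).Adj (v.star d).black (v.star d).white ∧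
      (cycleWithInterior p).Adj (v.star d').black (v.star d').white := by
  rcases hv with hv | ⟨c, hc, hv⟩
  · obtain ⟨a, b, hab, hset⟩ := Set.ncard_eq_two.1 (hp.ncard_neighborSet_toSubgraph_eq_two hv)
    have hadj : ∀ w, w = a ∨ w = b → (cycleWithInterior p).Adj v w := by
      intro w hw
      have : w ∈ p.toSubgraph.neighborSet v := by
        rw [hset]
        exact hw
      exact Or.inl ((p.adj_toSubgraph_iff_mem_edges).1 this)
    obtain ⟨d, h1, h2⟩ := exists_star_of_adj (hadj a (Or.inl rfl))
    obtain ⟨d', h1', h2'⟩ := exists_star_of_adj (hadj b (Or.inr rfl))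
    refine ⟨d, d', ?_, h1, h1'⟩
    rintro rfl
    rw [h2] at h2'
    exact hab (Sym2.congr_right.1 h2')
  · obtain ⟨d, hd⟩ := HexFace.mem_verts_iff_left.1 hv
    obtain ⟨d', hd'⟩ := HexFace.mem_verts_iff_right.1 hv
    refine ⟨d, d', ?_, hc.adj (Or.inl hd), hc.adj (Or.inr hd')⟩
    rintro rfl
    exact (v.star d).left_ne_right (hd.trans hd'.symm)

open Classical in
theorem sum_star_ite (e : HexEdge) (v : HexVertex) :
    (∑ d, if e = v.star d then (1 : ℤ) else 0) = if e.black = v ∨ e.white = v then 1 else 0 := by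
  split_ifs with h
  · obtain ⟨d, hd⟩ := HexVertex.exists_star_eq.2 h
    rw [Finset.sum_eq_single d]
    · rw [if_pos hd.symm]
    · intro d' _ hne
      rw [if_neg]
      intro h'
      exact hne (v.star_injective (h'.symm.trans hd.symm))
    · simp
  · refine Finset.sum_eq_zero fun d _ => if_neg fun h' => h ?_
    exact HexVertex.exists_star_eq.1 ⟨d, h'.symm⟩

/-- A finite subgraph without vertices of degree at most one that has a perfect matching has
another one. -/
theorem exists_isMatchingIndicator_ne {H : hexLattice.Subgraph} (hfin : H.verts.Finite)
    (hne : H.verts.Nonempty)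
    (hdeg : ∀ v ∈ H.verts, ∃ d d', d ≠ d' ∧ H.Adj (v.star d).black (v.star d).white ∧
      H.Adj (v.star d').black (v.star d').white) (hm₀ : IsMatchingIndicator H m₀) :
    ∃ m, IsMatchingIndicator H m ∧ m ≠ m₀ := by
  classical
  let D : Set HexVertex := {v | v ∈ H.verts ∧ ∃ e : HexEdge, e.black = v}
  have hD : D.Finite := hfin.subset fun v hv => hv.1
  have hstar : ∀ v ∈ D, ∀ d, (v.star d).black = v := by
    rintro _ ⟨-, e, rfl⟩ d
    exact ((e.black).star_end d).resolve_right fun h => e.black_ne_white _ h.symm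
  have h1 : ∀ v, ∃ e : HexEdge, v ∈ D → e.black = v ∧ H.Adj e.black e.white ∧ m₀ e = 0 := by
    intro v
    by_cases hv : v ∈ D
    · obtain ⟨d, d', hdd, ha, ha'⟩ := hdeg v hv.1
      by_cases h0 : m₀ (v.star d) = 0
      · exact ⟨_, fun _ => ⟨hstar v hv d, ha, h0⟩⟩
      · refine ⟨_, fun _ => ⟨hstar v hv d', ha', (hm₀.zero_or_one _).resolve_right fun h => hdd ?_⟩⟩
        exact hm₀.star_unique ((hm₀.zero_or_one _).resolve_left h0) h
    · exact ⟨(0, 0, 0), fun h => absurd h hv⟩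
  choose E hE using h1
  have h2 : ∀ v, ∃ e : HexEdge, v ∈ D → e.black = v ∧ m₀ e = 1 := by
    intro v
    by_cases hv : v ∈ D
    · obtain ⟨d, hd⟩ := hm₀.exists_star hv.1
      exact ⟨_, fun _ => ⟨hstar v hv d, hd⟩⟩
    · exact ⟨(0, 0, 0), fun h => absurd h hv⟩
  choose M hM using h2
  have hMu : ∀ v ∈ D, ∀ e : HexEdge, e.black = v → m₀ e = 1 → M v = e := by
    intro v hv e he hme
    obtain ⟨d, hd⟩ := HexVertex.exists_star_eq.2 (Or.inl (hM v hv).1)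
    obtain ⟨d', hd'⟩ := HexVertex.exists_star_eq.2 (Or.inl he)
    rw [← hd, ← hd', hm₀.star_unique (v := v) (d := d) (d' := d')]
    · rw [hd]; exact (hM v hv).2
    · rw [hd']; exact hme
  -- One step of an alternating path between black vertices: leave `v` along the unmatched edge `E
  -- v`, then follow the matching edge at its white end back to a black vertex.
  have h3 : ∀ v, ∃ w, v ∈ D → w ∈ D ∧ (M w).white = (E v).white := by
    intro v
    by_cases hv : v ∈ D
    · obtain ⟨d, hd⟩ := hm₀.exists_star (hE v hv).2.1.snd_mem
      have hadj := hm₀.adj _ (by rw [hd]; norm_num)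
      have hw : (HexVertex.star (E v).white d).black ∈ D := ⟨hadj.fst_mem, _, rfl⟩
      refine ⟨_, fun _ => ⟨hw, ?_⟩⟩
      rw [hMu _ hw _ rfl hd]
      exact ((E v).white.star_end d).resolve_left fun h => HexEdge.black_ne_white _ _ h
    · exact ⟨v, fun h => absurd h hv⟩
  choose f hf using h3
  have hfD : Set.MapsTo f D D := fun v hv => (hf v hv).1
  obtain ⟨v₀, hv₀⟩ := hne
  obtain ⟨d₀, -, -, hd₀, -⟩ := hdeg v₀ hv₀
  obtain ⟨y, hy, hpos⟩ := exists_minimalPeriod_pos hD hfD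
    (x := (v₀.star d₀).black) ⟨hd₀.fst_mem, _, rfl⟩
  set n := Function.minimalPeriod f y with hn
  have hmem : ∀ k, f^[k] y ∈ D := fun k => hfD.iterate k hy
  -- Adding `z` exchanges matched and unmatched edges along a periodic orbit. The minimal period
  -- makes its black vertices distinct, so each one has its edge exchanged once.
  let z : HexEdge → ℤ := fun e => ∑ k ∈ Finset.range n,
    ((if E (f^[k] y) = e then 1 else 0) - (if M (f^[k] y) = e then 1 else 0))
  have hz0 : ∀ e : HexEdge, (∀ k < n, f^[k] y ≠ e.black) → z e = 0 := by
    intro e he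
    refine Finset.sum_eq_zero fun k hk => ?_
    rw [if_neg, if_neg, sub_zero]
    · rintro rfl
      exact he k (Finset.mem_range.1 hk) (hM _ (hmem k)).1.symm
    · rintro rfl
      exact he k (Finset.mem_range.1 hk) (hE _ (hmem k)).1.symm
  have hz1 : ∀ e : HexEdge, ∀ k < n, f^[k] y = e.black →
      m₀ e + z e = if E (f^[k] y) = e then 1 else 0 := by
    intro e k hk hke
    have hze : z e = (if E (f^[k] y) = e then 1 else 0) - (if M (f^[k] y) = e then 1 else 0) := by
      refine Finset.sum_eq_single k (fun l hl hlk => ?_) fun h => absurd (Finset.mem_range.2 hk) h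
      have hne : f^[l] y ≠ e.black := fun h => hlk
        (Function.iterate_injOn_Iio_minimalPeriod (Finset.mem_range.1 hl) hk (h.trans hke.symm))
      rw [if_neg, if_neg, sub_zero]
      · rintro rfl
        exact hne (hM _ (hmem l)).1.symm
      · rintro rfl
        exact hne (hE _ (hmem l)).1.symm
    have hme : m₀ e = if M (f^[k] y) = e then 1 else 0 := by
      split_ifs with h
      · rw [← h]
        exact (hM _ (hmem k)).2
      · exact (hm₀.zero_or_one e).resolve_right fun h' => h (hMu _ (hmem k) e hke.symm h')
    rw [hze, hme]
    ring
  have htel : ∀ g : HexVertex → ℤ,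
      ∑ k ∈ Finset.range n, g (f^[k + 1] y) = ∑ k ∈ Finset.range n, g (f^[k] y) := by
    intro g
    have h1 := Finset.sum_range_succ' (fun k => g (f^[k] y)) n
    have h2 := Finset.sum_range_succ (fun k => g (f^[k] y)) n
    rw [h2, hn, Function.iterate_minimalPeriod] at h1
    rw [Function.iterate_zero, id] at h1
    linarith
  have hsum : ∀ v : HexVertex, ∑ d, z (v.star d) = 0 := by
    intro v
    simp only [z]
    rw [Finset.sum_comm]
    simp only [Finset.sum_sub_distrib, sum_star_ite]
    rw [sub_eq_zero]
    by_cases hv : ∃ e : HexEdge, e.black = v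
    · obtain ⟨e, rfl⟩ := hv
      refine Finset.sum_congr rfl fun k _ => ?_
      have hb : ∀ e' : HexEdge, (e'.black = e.black ∨ e'.white = e.black) ↔ e'.black = e.black :=
        fun e' => or_iff_left fun h => e.black_ne_white e' h.symm
      rw [if_congr (hb _) rfl rfl, if_congr (hb _) rfl rfl, (hE _ (hmem k)).1, (hM _ (hmem k)).1]
    -- At a white vertex the edge gained from one black vertex of the orbit cancels the edge lost
    -- from the next, hence the cyclic shift.
    · rw [← htel fun w => if (M w).black = v ∨ (M w).white = v then 1 else 0]
      refine Finset.sum_congr rfl fun k _ => ?_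
      have hb : ∀ e' : HexEdge, (e'.black = v ∨ e'.white = v) ↔ e'.white = v :=
        fun e' => or_iff_right fun h => hv ⟨e', h⟩
      simp only [hb]
      rw [Function.iterate_succ_apply', (hf _ (hmem k)).2]
  refine ⟨m₀ + z, ⟨fun e => ?_, fun e he => ?_, fun v hv => ?_⟩, fun heq => ?_⟩
  · by_cases he : ∃ k < n, f^[k] y = e.black
    · obtain ⟨k, hk, hke⟩ := he
      rw [Pi.add_apply, hz1 e k hk hke]
      split_ifs <;> simp
    · push Not at he
      rw [Pi.add_apply, hz0 e he, add_zero]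
      exact hm₀.zero_or_one e
  · by_cases hk : ∃ k < n, f^[k] y = e.black
    · obtain ⟨k, hk, hke⟩ := hk
      rw [Pi.add_apply, hz1 e k hk hke] at he
      have : E (f^[k] y) = e := by
        by_contra h
        exact he (if_neg h)
      rw [← this]
      exact (hE _ (hmem k)).2.1
    · push Not at hk
      rw [Pi.add_apply, hz0 e hk, add_zero] at he
      exact hm₀.adj e he
  · simp only [Pi.add_apply, Finset.sum_add_distrib, hsum, add_zero]
    exact hm₀.sum_star v hv
  · have h1 := hz1 (E y) 0 hpos (hE y hy).1.symm
    have h2 := congrFun heq (E y)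
    rw [Pi.add_apply, h1, Function.iterate_zero, id, if_pos rfl, (hE y hy).2.2] at h2
    omega

theorem nontrivial_heightLattice (hp : p.IsCycle) (hfin : (cycleWithInterior p).verts.Finite)
    (hm₀ : IsMatchingIndicator (cycleWithInterior p) m₀) :
    Nontrivial (heightLattice (cycleWithInterior p) m₀) := by
  obtain ⟨m, hm, hne⟩ := exists_isMatchingIndicator_ne hfin ⟨u, Or.inl p.start_mem_support⟩
    (fun v hv => exists_two_edges hp hv) hm₀
  obtain ⟨h, hh, heq⟩ := exists_height hfin hm₀ hm
  obtain ⟨h', hh', heq'⟩ := exists_height hfin hm₀ hm₀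
  refine ⟨⟨h, hh⟩, ⟨h', hh'⟩, fun hcon => hne ?_⟩
  rw [← heq, Subtype.mk.inj hcon, heq']

end Cover

/-! ### Clar covers as sets of edges -/

namespace ClarCover

variable {H : hexLattice.Subgraph} {C C' : SimpleGraph H.verts}

/-- The edge `e` of the lattice is an edge of `C`. -/
def HasEdge (C : SimpleGraph H.verts) (e : HexEdge) : Prop :=
  ∃ (hb : e.black ∈ H.verts) (hw : e.white ∈ H.verts), C.Adj ⟨e.black, hb⟩ ⟨e.white, hw⟩

theorem hasEdge_iff {e : HexEdge} {v w : H.verts} (h : e.toSym2 = s(v.1, w.1)) :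
    HasEdge C e ↔ C.Adj v w := by
  obtain ⟨v, hv⟩ := v
  obtain ⟨w, hw⟩ := w
  rcases Sym2.eq_iff.1 h with ⟨h1, h2⟩ | ⟨h1, h2⟩
  · simp only at h1 h2
    subst h1 h2
    exact ⟨fun h => h.2.2, fun h => ⟨hv, hw, h⟩⟩
  · simp only at h1 h2
    subst h1 h2
    exact ⟨fun h => h.2.2.symm, fun h => ⟨hw, hv, h.symm⟩⟩

theorem HasEdge.adj (hC : C ≤ H.coe) {e : HexEdge} (h : HasEdge C e) :
    H.Adj e.black e.white :=
  hC h.2.2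

theorem exists_star_of_adj (hC : C ≤ H.coe) {v w : H.verts} (h : C.Adj v w) :
    ∃ d, HasEdge C (v.1.star d) ∧ (v.1.star d).toSym2 = s(v.1, w.1) := by
  obtain ⟨d, -, hd⟩ := _root_.exists_star_of_adj (hC h)
  exact ⟨d, (hasEdge_iff hd).2 h, hd⟩

theorem exists_adj_of_hasEdge {v : H.verts} {d : Fin 3} (h : HasEdge C (v.1.star d)) :
    ∃ w, C.Adj v w ∧ (v.1.star d).toSym2 = s(v.1, w.1) := by
  rcases v.1.star_end d with hv | hv
  · have h' : (v.1.star d).toSym2 = s(v.1, (v.1.star d).white) := by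
      rw [HexEdge.toSym2, hv]
    exact ⟨⟨_, h.2.1⟩, (hasEdge_iff h').1 h, h'⟩
  · have h' : (v.1.star d).toSym2 = s(v.1, (v.1.star d).black) := by
      rw [HexEdge.toSym2, hv, Sym2.eq_swap]
    exact ⟨⟨_, h.1⟩, (hasEdge_iff h').1 h, h'⟩

theorem eq_of_hasEdge_iff (hC : C ≤ H.coe) (hC' : C' ≤ H.coe)
    (h : ∀ e, HasEdge C e ↔ HasEdge C' e) : C = C' := by
  ext v w
  constructor
  · intro hvw
    obtain ⟨d, hd, hs⟩ := exists_star_of_adj hC hvw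
    exact (hasEdge_iff hs).1 ((h _).1 hd)
  · intro hvw
    obtain ⟨d, hd, hs⟩ := exists_star_of_adj hC' hvw
    exact (hasEdge_iff hs).1 ((h _).2 hd)

theorem existsUnique_hasEdge (hC : C ≤ H.coe) {v : H.verts} (h : ∃! w, C.Adj v w) :
    ∃! d, HasEdge C (v.1.star d) := by
  obtain ⟨w, hw, hu⟩ := h
  obtain ⟨d, hd, hs⟩ := exists_star_of_adj hC hw
  refine ⟨d, hd, fun d' hd' => ?_⟩
  obtain ⟨w', hw', hs'⟩ := exists_adj_of_hasEdge hd'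
  rw [hu w' hw', ← hs] at hs'
  exact v.1.star_injective (HexEdge.toSym2_injective hs')

theorem supp_subset_of_closed {T : Set H.verts} (hT : ∀ v ∈ T, ∀ w, C.Adj v w → w ∈ T)
    {v : H.verts} (hv : v ∈ T) : (C.connectedComponentMk v).supp ⊆ T := by
  intro w hw
  obtain ⟨q⟩ := (SimpleGraph.ConnectedComponent.exact hw).symm
  induction q with
  | nil => exact hv
  | cons hadj q ih =>
    exact ih (hT _ hv _ hadj) ((SimpleGraph.ConnectedComponent.sound q.reachable).symm)

theorem hexFace_mem_verts_of_edge {c : HexFace} {e : HexEdge} (h : e.left = c ∨ e.right = c) :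
    e.black ∈ c.verts ∧ e.white ∈ c.verts :=
  ⟨(HexFace.toSym2_mem_edges.2 h).2 _ (Sym2.mem_mk_left _ _),
    (HexFace.toSym2_mem_edges.2 h).2 _ (Sym2.mem_mk_right _ _)⟩

theorem star_mem_face {c : HexFace} {v : HexVertex} {d : Fin 3}
    (h : (v.star d).left = c ∨ (v.star d).right = c) : v ∈ c.verts := by
  rcases v.star_end d with hv | hv
  · have := (hexFace_mem_verts_of_edge h).1
    rwa [hv] at this
  · have := (hexFace_mem_verts_of_edge h).2
    rwa [hv] at this

theorem edge_of_mem_verts {c : HexFace} {e : HexEdge} (hb : e.black ∈ c.verts)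
    (hw : e.white ∈ c.verts) : e.left = c ∨ e.right = c := by
  refine HexFace.toSym2_mem_edges.1 ⟨e.toSym2_mem_edgeSet, fun v hv => ?_⟩
  rcases Sym2.mem_iff.1 hv with rfl | rfl <;> assumption

/-- Near a hexagon component the cover consists of the edges of the hexagon. -/
theorem hasEdge_iff_of_hexagon {K : C.ConnectedComponent} {c : HexFace}
    (hs : Subtype.val '' K.supp = c.verts)
    (hK : ∀ v ∈ K.supp, ∀ w ∈ K.supp, hexLattice.Adj v.1 w.1 → C.Adj v w) {v : HexVertex}
    (hv : v ∈ c.verts) (d : Fin 3) :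
    HasEdge C (v.star d) ↔ (v.star d).left = c ∨ (v.star d).right = c := by
  constructor
  · intro h
    rw [← hs] at hv
    obtain ⟨v, hvK, rfl⟩ := hv
    obtain ⟨w, hw, hvw⟩ := exists_adj_of_hasEdge h
    have hwK : w ∈ K.supp := (SimpleGraph.ConnectedComponent.mem_supp_congr_adj K hw).1 hvK
    refine HexFace.toSym2_mem_edges.1 ⟨HexEdge.toSym2_mem_edgeSet _, fun x hx => ?_⟩
    rw [hvw, Sym2.mem_iff] at hx
    rw [← hs]
    rcases hx with rfl | rfl
    exacts [⟨_, hvK, rfl⟩, ⟨_, hwK, rfl⟩]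
  · intro h
    obtain ⟨h1, h2⟩ := hexFace_mem_verts_of_edge h
    rw [← hs] at h1 h2
    obtain ⟨x, hx, hx'⟩ := h1
    obtain ⟨y, hy, hy'⟩ := h2
    have hxy : (v.star d).toSym2 = s(x.1, y.1) := by rw [hx', hy']; rfl
    exact (hasEdge_iff hxy).2 (hK x hx y hy (by rw [hx', hy']; exact HexEdge.adj _))

/-- The local structure of a Clar cover. -/
theorem local_structure (hC : IsClarCover H C) {v : HexVertex} (hv : v ∈ H.verts) :
    (∃! d, HasEdge C (v.star d)) ∨
      ∃ c : HexFace, v ∈ c.verts ∧ ∀ w ∈ c.verts, ∀ d,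
        (HasEdge C (w.star d) ↔ (w.star d).left = c ∨ (w.star d).right = c) := by
  have hvK : (⟨v, hv⟩ : H.verts) ∈ (C.connectedComponentMk ⟨v, hv⟩).supp := rfl
  rcases hC.2 (C.connectedComponentMk ⟨v, hv⟩) with ⟨c, hs, hK⟩ | ⟨a, b, hab, hs⟩
  · right
    refine ⟨c, ?_, fun w hw d => hasEdge_iff_of_hexagon hs hK hw d⟩
    rw [← hs]
    exact ⟨_, hvK, rfl⟩
  · left
    refine existsUnique_hasEdge hC.1 (v := ⟨v, hv⟩) ?_
    have hmem : ∀ w, C.Adj ⟨v, hv⟩ w → w = a ∨ w = b := by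
      intro w hw
      have : w ∈ (C.connectedComponentMk ⟨v, hv⟩).supp :=
        (SimpleGraph.ConnectedComponent.mem_supp_congr_adj _ hw).1 hvK
      rw [hs] at this
      exact this
    rw [hs] at hvK
    rcases hvK with h | h
    · rw [h] at hmem ⊢
      exact ⟨b, hab, fun w hw => (hmem w hw).resolve_left fun h' => hw.ne h'.symm⟩
    · rw [Set.mem_singleton_iff.1 h] at hmem ⊢
      exact ⟨a, hab.symm, fun w hw => (hmem w hw).resolve_right fun h' => hw.ne h'.symm⟩

/-- The hexagons all of whose edges belong to `C`. -/
def fullHexagons (C : SimpleGraph H.verts) : Set HexFace :=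
  {c | ∀ e : HexEdge, e.left = c ∨ e.right = c → HasEdge C e}

/-- A vertex of a full hexagon has two cover edges, so it lies in a hexagon component; those two
edges force that component to be `c`. -/
theorem fullHexagons_hasEdge (hC : IsClarCover H C) {c : HexFace} (hc : c ∈ fullHexagons C)
    {v : HexVertex} (hv : v ∈ c.verts) {d : Fin 3} (hd : HasEdge C (v.star d)) :
    (v.star d).left = c ∨ (v.star d).right = c := by
  obtain ⟨d₁, h1⟩ := HexFace.mem_verts_iff_left.1 hv
  obtain ⟨d₂, h2⟩ := HexFace.mem_verts_iff_right.1 hv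
  have e1 := hc _ (Or.inl h1)
  have e2 := hc _ (Or.inr h2)
  have hvH : v ∈ H.verts := IsMatchingIndicator.star_mem (e1.adj hC.1)
  rcases local_structure hC hvH with hu | ⟨x, hx, hx'⟩
  · have := hu.unique e1 e2
    subst this
    exact absurd (h1.trans h2.symm) (v.star d₁).left_ne_right
  · rw [hx' v hx] at e1 e2 hd
    rcases e1 with e1 | e1
    · rw [h1] at e1
      rwa [e1]
    · rcases e2 with e2 | e2
      · exact absurd (e1.trans e2.symm) (HexVertex.right_ne_left_of_left_eq_right (h1.trans h2.symm))
      · rw [h2] at e2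
        rwa [e2]

/-- If two full hexagons shared an edge, the other edge of one of them at an end of the shared edge
would be a cover edge leaving the other. -/
theorem left_notMem_fullHexagons (hC : IsClarCover H C) {e : HexEdge}
    (hc : e.right ∈ fullHexagons C) : e.left ∉ fullHexagons C := by
  intro hl
  have hv : e.black ∈ e.right.verts := (hexFace_mem_verts_of_edge (Or.inr rfl)).1
  obtain ⟨d, hd⟩ := HexFace.mem_verts_iff_left.1 hv
  have hv' : e.black ∈ e.left.verts := (hexFace_mem_verts_of_edge (Or.inl rfl)).1
  rcases fullHexagons_hasEdge hC hl hv' (hc _ (Or.inl hd)) with h | h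
  · exact e.left_ne_right (h.symm.trans hd)
  · exact HexVertex.right_ne_left_of_left_eq_right (v := e.black) (d := d) (d' := e.dir) hd h

open Classical in
/-- The perfect matching of a Clar cover: every hexagon is replaced by its proper edges. -/
noncomputable def toMatching (C : SimpleGraph H.verts) (e : HexEdge) : ℤ :=
  if HasEdge C e ∧ e.left ∉ fullHexagons C then 1 else 0

theorem toMatching_eq_one {e : HexEdge} :
    toMatching C e = 1 ↔ HasEdge C e ∧ e.left ∉ fullHexagons C := by
  unfold toMatching
  split_ifs with h <;> simp [h]

theorem sum_eq_one_of_existsUnique {m : Fin 3 → ℤ} (h01 : ∀ d, m d = 0 ∨ m d = 1)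
    (h : ∃! d, m d = 1) : ∑ d, m d = 1 := by
  obtain ⟨d, hd, hu⟩ := h
  rw [Finset.sum_eq_single d (fun d' _ hne => (h01 d').resolve_right fun h => hne (hu d' h))
    (by simp)]
  exact hd

/-- A vertex of an edge component keeps its only edge; on a hexagon component it keeps the edge with
that hexagon on the right. -/
theorem isMatchingIndicator_toMatching (hC : IsClarCover H C) :
    IsMatchingIndicator H (toMatching C) := by
  have h01 : ∀ e, toMatching C e = 0 ∨ toMatching C e = 1 := by
    intro e
    unfold toMatching
    split_ifs <;> simp
  refine ⟨h01, fun e he => ((toMatching_eq_one.1 ((h01 e).resolve_left he)).1).adj hC.1,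
    fun v hv => sum_eq_one_of_existsUnique (fun d => h01 _) ?_⟩
  simp only [toMatching_eq_one]
  rcases local_structure hC hv with ⟨d, hd, hu⟩ | ⟨c, hc, hc'⟩
  · refine ⟨d, ⟨hd, fun hl => ?_⟩, fun d' hd' => hu d' hd'.1⟩
    have hv' : v ∈ (v.star d).left.verts := HexFace.mem_verts_iff_left.2 ⟨d, rfl⟩
    obtain ⟨d', h'⟩ := HexFace.mem_verts_iff_right.1 hv'
    have := hu d' (hl _ (Or.inr h'))
    subst this
    exact (v.star d').left_ne_right h'.symm
  · have hfull : c ∈ fullHexagons C := by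
      intro e he
      rw [← e.star_black]
      exact (hc' _ (hexFace_mem_verts_of_edge he).1 _).2 he
    obtain ⟨d, hd⟩ := HexFace.mem_verts_iff_right.1 hc
    refine ⟨d, ⟨(hc' v hc d).2 (Or.inr hd), left_notMem_fullHexagons hC (by rwa [hd])⟩, ?_⟩
    rintro d' ⟨h1, h2⟩
    rcases (hc' v hc d').1 h1 with h | h
    · exact absurd (by rwa [h]) h2
    · exact v.right_star_injective (h.trans hd.symm)

theorem isProperSextet_toMatching (hC : IsClarCover H C) {c : HexFace}
    (hc : c ∈ fullHexagons C) : IsProperSextet H (toMatching C) c := by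
  refine fun e => ⟨fun h => (hc e (Or.inl h)).adj hC.1, fun h => toMatching_eq_one.2
    ⟨hc e (Or.inr h), left_notMem_fullHexagons hC (by rwa [h])⟩⟩

/-! ### The Clar cover of a perfect matching with selected proper sextets -/

/-- The subgraph with the edges of the matching `m` and the edges of the hexagons in `S`. -/
def ofMatching (H : hexLattice.Subgraph) (m : HexEdge → ℤ) (S : Set HexFace) :
    SimpleGraph H.verts where
  -- Only left edges need to be added: the right edges of a proper sextet already belong to the
  -- matching.
  Adj v w := ∃ e : HexEdge, (m e = 1 ∨ e.left ∈ S) ∧ e.toSym2 = s(v.1, w.1)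
  symm := ⟨fun _ _ ⟨e, he, h⟩ => ⟨e, he, h.trans Sym2.eq_swap⟩⟩
  loopless := ⟨fun v ⟨e, _, h⟩ => by
    rcases Sym2.eq_iff.1 h with ⟨h1, h2⟩ | ⟨h1, h2⟩ <;>
    exact e.black_ne_white e (h1.trans h2.symm)⟩

variable {m : HexEdge → ℤ} {S : Set HexFace}

theorem ofMatching_adj (hm : IsMatchingIndicator H m) (hS : ∀ c ∈ S, IsProperSextet H m c)
    {e : HexEdge} (he : m e = 1 ∨ e.left ∈ S) : H.Adj e.black e.white := by
  rcases he with he | he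
  · exact hm.adj e (by omega)
  · exact (hS _ he e).1 rfl

theorem hasEdge_ofMatching (hm : IsMatchingIndicator H m) (hS : ∀ c ∈ S, IsProperSextet H m c)
    {e : HexEdge} : HasEdge (ofMatching H m S) e ↔ m e = 1 ∨ e.left ∈ S := by
  constructor
  · rintro ⟨hb, hw, e', he', h⟩
    rwa [← HexEdge.toSym2_injective (a₁ := e') (a₂ := e) h]
  · intro he
    have h := ofMatching_adj hm hS he
    exact ⟨h.fst_mem, h.snd_mem, e, he, rfl⟩

theorem ofMatching_le (hm : IsMatchingIndicator H m) (hS : ∀ c ∈ S, IsProperSextet H m c) :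
    ofMatching H m S ≤ H.coe := by
  rintro ⟨v, hv⟩ ⟨w, hw⟩ ⟨e, he, h⟩
  have hadj := ofMatching_adj hm hS he
  rcases Sym2.eq_iff.1 h with ⟨h1, h2⟩ | ⟨h1, h2⟩
  · simp only at h1 h2
    subst h1 h2
    exact hadj
  · simp only at h1 h2
    subst h1 h2
    exact hadj.symm

/-- At a vertex of a hexagon of `S`, the matching edge belongs to the hexagon. -/
theorem right_eq_of_mem (hm : IsMatchingIndicator H m) (hS : ∀ c ∈ S, IsProperSextet H m c)
    {c : HexFace} (hc : c ∈ S) {v : HexVertex} (hv : v ∈ c.verts) {d : Fin 3}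
    (hd : m (v.star d) = 1) : (v.star d).right = c := by
  obtain ⟨d', hd'⟩ := HexFace.mem_verts_iff_right.1 hv
  rw [hm.star_unique hd ((hS c hc _).2 hd'), hd']

/-- The matching edge at a vertex has every hexagon of `S` through that vertex on its right. Hence
the hexagons of `S` are pairwise disjoint, and no edge leaves them. -/
theorem ofMatching_hasEdge_iff (hm : IsMatchingIndicator H m)
    (hS : ∀ c ∈ S, IsProperSextet H m c) {c : HexFace} (hc : c ∈ S) {v : HexVertex}
    (hv : v ∈ c.verts) {d : Fin 3} :
    HasEdge (ofMatching H m S) (v.star d) ↔ (v.star d).left = c ∨ (v.star d).right = c := by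
  rw [hasEdge_ofMatching hm hS]
  constructor
  · rintro (h | h)
    · exact Or.inr (right_eq_of_mem hm hS hc hv h)
    · obtain ⟨d', hd'⟩ := HexFace.mem_verts_iff_right.1 hv
      left
      rw [← hd', right_eq_of_mem hm hS h (star_mem_face (Or.inl rfl)) ((hS c hc _).2 hd')]
  · rintro (h | h)
    · exact Or.inr (h ▸ hc)
    · exact Or.inl ((hS c hc _).2 h)

theorem fullHexagons_ofMatching (hm : IsMatchingIndicator H m)
    (hS : ∀ c ∈ S, IsProperSextet H m c) : fullHexagons (ofMatching H m S) = S := by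
  ext c
  constructor
  · intro hc
    by_contra hcS
    have hv : (c.leftEdge 0).black ∈ c.verts :=
      (hexFace_mem_verts_of_edge (Or.inl (c.left_leftEdge 0))).1
    obtain ⟨d, hd⟩ := HexFace.mem_verts_iff_left.1 hv
    obtain ⟨d', hd'⟩ := HexFace.mem_verts_iff_right.1 hv
    -- For a full hexagon outside `S`, its left edge at this vertex must be matched. Its right edge
    -- is then either a second matched edge or borders a hexagon of `S` that would share both edges
    -- with `c`.
    have h1 := ((hasEdge_ofMatching hm hS).1 (hc _ (Or.inl hd))).resolve_right (by rwa [hd])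
    rcases (hasEdge_ofMatching hm hS).1 (hc _ (Or.inr hd')) with h2 | h2
    · have := hm.star_unique h1 h2
      subst this
      exact HexEdge.left_ne_right _ (hd.trans hd'.symm)
    · have h3 := right_eq_of_mem hm hS h2 (star_mem_face (Or.inl rfl)) h1
      exact HexVertex.right_ne_left_of_left_eq_right (hd.trans hd'.symm) h3
  · intro hc e he
    rw [← e.star_black]
    exact (ofMatching_hasEdge_iff hm hS hc (hexFace_mem_verts_of_edge he).1).2 he

theorem toMatching_ofMatching (hm : IsMatchingIndicator H m)
    (hS : ∀ c ∈ S, IsProperSextet H m c) : toMatching (ofMatching H m S) = m := by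
  funext e
  have h : toMatching (ofMatching H m S) e = 1 ↔ m e = 1 := by
    rw [toMatching_eq_one, fullHexagons_ofMatching hm hS, hasEdge_ofMatching hm hS]
    constructor
    · rintro ⟨h1, h2⟩
      exact h1.resolve_right h2
    · intro h
      refine ⟨Or.inl h, fun hl => ?_⟩
      have := hm.eq_zero_of_left (hS _ hl)
      omega
  have h1 := hm.zero_or_one e
  have h2 : toMatching (ofMatching H m S) e = 0 ∨ toMatching (ofMatching H m S) e = 1 := by
    unfold toMatching
    split_ifs <;> simp
  omega

theorem ofMatching_toMatching (hC : IsClarCover H C) :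
    ofMatching H (toMatching C) (fullHexagons C) = C := by
  have hm := isMatchingIndicator_toMatching hC
  have hS : ∀ c ∈ fullHexagons C, IsProperSextet H (toMatching C) c :=
    fun c hc => isProperSextet_toMatching hC hc
  refine eq_of_hasEdge_iff (ofMatching_le hm hS) hC.1 fun e => ?_
  rw [hasEdge_ofMatching hm hS, toMatching_eq_one]
  constructor
  · rintro (h | h)
    exacts [h.1, h e (Or.inl rfl)]
  · intro h
    by_cases hl : e.left ∈ fullHexagons C
    exacts [Or.inr hl, Or.inl ⟨h, hl⟩]

theorem mem_verts_of_mem (hS : ∀ c ∈ S, IsProperSextet H m c)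
    {c : HexFace} (hc : c ∈ S) {v : HexVertex} (hv : v ∈ c.verts) : v ∈ H.verts := by
  obtain ⟨d, hd⟩ := HexFace.mem_verts_iff_left.1 hv
  exact IsMatchingIndicator.star_mem ((hS c hc _).1 hd)

/-- The component of the vertices of a hexagon in `S` is this hexagon. -/
theorem supp_ofMatching (hm : IsMatchingIndicator H m) (hS : ∀ c ∈ S, IsProperSextet H m c)
    {c : HexFace} (hc : c ∈ S) {v : H.verts} (hv : v.1 ∈ c.verts) :
    Subtype.val '' ((ofMatching H m S).connectedComponentMk v).supp = c.verts := by
  classical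
  refine Set.Subset.antisymm ?_ ?_
  · rintro _ ⟨w, hw, rfl⟩
    refine supp_subset_of_closed (C := ofMatching H m S) (T := {w | w.1 ∈ c.verts}) ?_ hv hw
    intro x hx y hxy
    obtain ⟨d, hd, hs⟩ := exists_star_of_adj (ofMatching_le hm hS) hxy
    have he := (ofMatching_hasEdge_iff hm hS hc hx).1 hd
    refine (HexFace.toSym2_mem_edges.2 he).2 _ ?_
    rw [hs]
    exact Sym2.mem_mk_right _ _
  · intro w hw
    -- The component of a vertex, with `none` off `H` so that the function is total; it is constant
    -- around the hexagon, which is therefore connected in the cover.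
    let A : HexVertex → Option (ofMatching H m S).ConnectedComponent := fun x =>
      if hx : x ∈ H.verts then some ((ofMatching H m S).connectedComponentMk ⟨x, hx⟩) else none
    have hA : ∀ e : HexEdge, e.left = c ∨ e.right = c → A e.black = A e.white := by
      intro e he
      have hv := hexFace_mem_verts_of_edge he
      have h1 := mem_verts_of_mem hS hc hv.1
      have h2 := mem_verts_of_mem hS hc hv.2
      simp only [A, dif_pos h1, dif_pos h2]
      congr 1
      apply SimpleGraph.ConnectedComponent.connectedComponentMk_eq_of_adj
      refine ⟨e, ?_, rfl⟩
      rcases he with rfl | he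
      exacts [Or.inr hc, Or.inl ((hS c hc e).2 he)]
    have hwH := mem_verts_of_mem hS hc hw
    have heq := (HexFace.eq_of_forall_edge hA hw).trans (HexFace.eq_of_forall_edge hA hv).symm
    simp only [A, dif_pos hwH, dif_pos v.2] at heq
    exact ⟨⟨w, hwH⟩, Option.some.inj heq, rfl⟩

theorem isHexagonComponent_ofMatching (hm : IsMatchingIndicator H m)
    (hS : ∀ c ∈ S, IsProperSextet H m c) {c : HexFace} (hc : c ∈ S) {v : H.verts}
    (hv : v.1 ∈ c.verts) :
    IsHexagonComponent (ofMatching H m S) ((ofMatching H m S).connectedComponentMk v) := by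
  have hsupp := supp_ofMatching hm hS hc hv
  refine ⟨c, hsupp, fun x hx y hy hxy => ?_⟩
  have hx' : x.1 ∈ c.verts := hsupp ▸ ⟨x, hx, rfl⟩
  have hy' : y.1 ∈ c.verts := hsupp ▸ ⟨y, hy, rfl⟩
  obtain ⟨e, he⟩ := hexLattice_adj_iff.1 hxy
  have hs : e.toSym2 = s(x.1, y.1) := by
    rcases he with ⟨h1, h2⟩ | ⟨h1, h2⟩
    · rw [h1, h2]; rfl
    · rw [h1, h2]; exact Sym2.eq_swap
  have hec : e.left = c ∨ e.right = c := by
    rcases he with ⟨h1, h2⟩ | ⟨h1, h2⟩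
    · exact edge_of_mem_verts (h1 ▸ hx') (h2 ▸ hy')
    · exact edge_of_mem_verts (h2 ▸ hy') (h1 ▸ hx')
  refine ⟨e, ?_, hs⟩
  rcases hec with rfl | h
  exacts [Or.inr hc, Or.inl ((hS c hc e).2 h)]

/-- Away from the hexagons of `S` only matching edges remain, and they never lead back to such a
hexagon, so the other components are single edges. -/
theorem isClarCover_ofMatching (hm : IsMatchingIndicator H m)
    (hS : ∀ c ∈ S, IsProperSextet H m c) : IsClarCover H (ofMatching H m S) := by
  have hle := ofMatching_le hm hS
  refine ⟨hle, fun K => ?_⟩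
  induction K using SimpleGraph.ConnectedComponent.ind with | _ v
  by_cases hv : ∃ c ∈ S, v.1 ∈ c.verts
  · obtain ⟨c, hc, hv⟩ := hv
    exact Or.inl (isHexagonComponent_ofMatching hm hS hc hv)
  · right
    have huniq : ∀ x : H.verts, (¬ ∃ c ∈ S, x.1 ∈ c.verts) → ∀ d,
        HasEdge (ofMatching H m S) (x.1.star d) → m (x.1.star d) = 1 := by
      intro x hx d hd
      refine ((hasEdge_ofMatching hm hS).1 hd).resolve_right fun h => hx ?_
      exact ⟨_, h, star_mem_face (Or.inl rfl)⟩
    have hstep : ∀ x : H.verts, (¬ ∃ c ∈ S, x.1 ∈ c.verts) → ∀ y,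
        (ofMatching H m S).Adj x y → ¬ ∃ c ∈ S, y.1 ∈ c.verts := by
      rintro x hx y hxy ⟨c, hc, hy⟩
      obtain ⟨d, hd, hs⟩ := exists_star_of_adj hle hxy.symm
      have he := (ofMatching_hasEdge_iff hm hS hc hy).1 hd
      refine hx ⟨c, hc, (HexFace.toSym2_mem_edges.2 he).2 _ ?_⟩
      rw [hs]
      exact Sym2.mem_mk_right _ _
    have hone : ∀ x : H.verts, (¬ ∃ c ∈ S, x.1 ∈ c.verts) → ∀ y z,
        (ofMatching H m S).Adj x y → (ofMatching H m S).Adj x z → y = z := by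
      intro x hx y z hy hz
      obtain ⟨d, hd, hs⟩ := exists_star_of_adj hle hy
      obtain ⟨d', hd', hs'⟩ := exists_star_of_adj hle hz
      rw [hm.star_unique (huniq x hx d hd) (huniq x hx d' hd'), hs'] at hs
      exact (Subtype.ext (Sym2.congr_right.1 hs)).symm
    obtain ⟨d, hd⟩ := hm.exists_star v.2
    obtain ⟨w, hw, -⟩ := exists_adj_of_hasEdge (C := ofMatching H m S)
      ((hasEdge_ofMatching hm hS).2 (Or.inl hd))
    refine ⟨v, w, hw, Set.Subset.antisymm (supp_subset_of_closed ?_ (Or.inl rfl)) ?_⟩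
    · rintro x (rfl | rfl) y hy
      · exact Or.inr (hone x hv y w hy hw)
      · exact Or.inl (hone _ (hstep v hv _ hw) y v hy hw.symm)
    · rintro x (rfl | rfl)
      · rfl
      · exact SimpleGraph.ConnectedComponent.connectedComponentMk_eq_of_adj hw.symm

theorem hexagonCount_ofMatching (hm : IsMatchingIndicator H m)
    (hS : ∀ c ∈ S, IsProperSextet H m c) : hexagonCount (ofMatching H m S) = S.ncard := by
  have hmem : ∀ c : HexFace, ((c.1, c.2, false) : HexVertex) ∈ c.verts := fun c => Or.inl rfl
  symm
  refine Set.ncard_congr (fun c hc => (ofMatching H m S).connectedComponentMk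
    ⟨(c.1, c.2, false), mem_verts_of_mem hS hc (hmem c)⟩) ?_ ?_ ?_
  · intro c hc
    exact isHexagonComponent_ofMatching hm hS hc (hmem c)
  · intro c c' hc hc' h
    apply HexFace.eq_of_verts_subset
    rw [← supp_ofMatching hm hS hc (v := ⟨_, mem_verts_of_mem hS hc (hmem c)⟩) (hmem c),
      ← supp_ofMatching hm hS hc' (v := ⟨_, mem_verts_of_mem hS hc' (hmem c')⟩) (hmem c'), h]
  · rintro K ⟨c, hs, hK⟩
    have hc : c ∈ S := by
      rw [← fullHexagons_ofMatching hm hS]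
      intro e he
      rw [← e.star_black]
      exact (hasEdge_iff_of_hexagon hs hK
        (hexFace_mem_verts_of_edge he).1 _).2 he
    refine ⟨c, hc, ?_⟩
    have h := hmem c
    rw [← hs] at h
    obtain ⟨x, hx, hx'⟩ := h
    rw [← hx]
    congr 1
    exact Subtype.ext hx'.symm

end ClarCover

/-! ### The Clar covering polynomial -/

section ClarPolynomial

variable {H : hexLattice.Subgraph}

theorem finite_setOf_isProperSextet (hfin : H.verts.Finite) (m : HexEdge → ℤ) :
    {c | IsProperSextet H m c}.Finite := by
  refine (Set.Finite.preimage (f := fun e : HexFace => ((e.1, e.2, false) : HexVertex)) ?_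
    hfin).subset ?_
  · rintro ⟨a, b⟩ _ ⟨a', b'⟩ _ h
    simpa using h
  · rintro ⟨a, b⟩ hc
    exact ((hc (a, b, 2)).1 rfl).fst_mem

/-- Covers with `k` hexagons correspond bijectively to pairs of a perfect matching and a `k`-subset
of its proper sextets. -/
theorem clarCoverCount_eq (hfin : H.verts.Finite) (k : ℕ) :
    clarCoverCount H k = ∑ m ∈ (finite_setOf_isMatchingIndicator hfin).toFinset,
      {c | IsProperSextet H m c}.ncard.choose k := by
  classical
  let T : Finset (Σ _ : HexEdge → ℤ, Finset HexFace) :=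
    (finite_setOf_isMatchingIndicator hfin).toFinset.sigma fun m =>
      (finite_setOf_isProperSextet hfin m).toFinset.powersetCard k
  have hT : ∀ x, x ∈ T ↔ IsMatchingIndicator H x.1 ∧ (∀ c ∈ (x.2 : Set HexFace),
      IsProperSextet H x.1 c) ∧ x.2.card = k := by
    rintro ⟨m, S⟩
    simp [T, Finset.mem_powersetCard, Finset.subset_iff]
  have himage : {C : SimpleGraph H.verts | IsClarCover H C ∧ ClarCover.hexagonCount C = k} =
      (fun x : Σ _ : HexEdge → ℤ, Finset HexFace =>
        ClarCover.ofMatching H x.1 (x.2 : Set HexFace)) '' (T : Set _) := by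
    ext C
    constructor
    · rintro ⟨hC, hk⟩
      have hm := ClarCover.isMatchingIndicator_toMatching hC
      have hS : ∀ c ∈ ClarCover.fullHexagons C, IsProperSextet H (ClarCover.toMatching C) c :=
        fun c hc => ClarCover.isProperSextet_toMatching hC hc
      have hSfin : (ClarCover.fullHexagons C).Finite :=
        (finite_setOf_isProperSextet hfin _).subset hS
      have hcount := ClarCover.hexagonCount_ofMatching hm hS
      rw [ClarCover.ofMatching_toMatching hC, hk, Set.ncard_eq_toFinset_card _ hSfin] at hcount
      refine ⟨⟨ClarCover.toMatching C, hSfin.toFinset⟩, Finset.mem_coe.2 ((hT _).2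
        ⟨hm, by simpa using hS, hcount.symm⟩), ?_⟩
      simpa using ClarCover.ofMatching_toMatching hC
    · rintro ⟨⟨m, S⟩, hx, rfl⟩
      obtain ⟨hm, hS, hk⟩ := (hT _).1 (Finset.mem_coe.1 hx)
      refine ⟨ClarCover.isClarCover_ofMatching hm hS, ?_⟩
      rw [ClarCover.hexagonCount_ofMatching hm hS, Set.ncard_coe_finset]
      exact hk
  unfold clarCoverCount
  rw [himage, Set.InjOn.ncard_image, Set.ncard_coe_finset, Finset.card_sigma]
  · refine Finset.sum_congr rfl fun m _ => ?_
    rw [Finset.card_powersetCard, Set.ncard_eq_toFinset_card _ (finite_setOf_isProperSextet hfin m)]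
  · rintro ⟨m, S⟩ hx ⟨m', S'⟩ hx' h
    obtain ⟨hm, hS, -⟩ := (hT _).1 (Finset.mem_coe.1 hx)
    obtain ⟨hm', hS', -⟩ := (hT _).1 (Finset.mem_coe.1 hx')
    simp only at hm hS hm' hS' h
    have h1 := ClarCover.toMatching_ofMatching hm hS
    have h2 := ClarCover.fullHexagons_ofMatching hm hS
    rw [h, ClarCover.toMatching_ofMatching hm' hS'] at h1
    rw [h, ClarCover.fullHexagons_ofMatching hm' hS'] at h2
    rw [h1, Finset.coe_injective h2]

theorem clarCoverCount_eq_zero (hfin : H.verts.Finite) {k : ℕ} (hk : clarNumber H < k) :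
    clarCoverCount H k = 0 := by
  have : Finite H.verts := hfin
  -- Needed because `sSup` in `ℕ` takes the default value 0 on unbounded sets.
  have hbdd : BddAbove {k | ∃ C : SimpleGraph H.verts, IsClarCover H C ∧
      ClarCover.hexagonCount C = k} := by
    refine Set.Finite.bddAbove ((Set.finite_range
      (ClarCover.hexagonCount (H := H))).subset ?_)
    rintro k ⟨C, -, rfl⟩
    exact ⟨C, rfl⟩
  unfold clarCoverCount
  rw [Set.ncard_eq_zero]
  refine Set.eq_empty_of_forall_notMem fun C hC => ?_
  exact absurd (le_csSup hbdd ⟨C, hC⟩) (not_le.2 hk)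

/-- The Clar covering polynomial in terms of proper sextets of perfect matchings. -/
theorem clarCoveringPolynomial_eq (hfin : H.verts.Finite) :
    clarCoveringPolynomial H = ∑ m ∈ (finite_setOf_isMatchingIndicator hfin).toFinset,
      (X + 1) ^ {c | IsProperSextet H m c}.ncard := by
  ext k
  have hk : (clarCoveringPolynomial H).coeff k = clarCoverCount H k := by
    unfold clarCoveringPolynomial
    simp only [finsetSum_coeff, coeff_C_mul, coeff_X_pow, mul_ite, mul_one, mul_zero]
    rw [Finset.sum_ite_eq]
    split_ifs with h
    · rfl
    · rw [clarCoverCount_eq_zero hfin (by simpa using h)]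
      rfl
  rw [hk, clarCoverCount_eq hfin, finsetSum_coeff, Nat.cast_sum]
  refine Finset.sum_congr rfl fun m _ => ?_
  rw [coeff_X_add_one_pow]

theorem IsKekulean.exists_isMatchingIndicator (hK : IsKekulean H) :
    ∃ m, IsMatchingIndicator H m := by
  classical
  obtain ⟨M, hM, hspan⟩ := hK
  have hle : M.spanningCoe ≤ H.coe := M.spanningCoe_le
  refine ⟨fun e => if ClarCover.HasEdge M.spanningCoe e then 1 else 0, fun e => ?_,
    fun e he => ?_, fun v hv => ?_⟩
  · split_ifs <;> simp
  · refine ClarCover.HasEdge.adj hle ?_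
    by_contra h
    exact he (if_neg h)
  · refine ClarCover.sum_eq_one_of_existsUnique (fun d => by split_ifs <;> simp) ?_
    obtain ⟨d, hd, hu⟩ := ClarCover.existsUnique_hasEdge hle (v := ⟨v, hv⟩)
      (hM (hspan ⟨v, hv⟩))
    refine ⟨d, if_pos hd, fun d' hd' => hu d' ?_⟩
    by_contra h
    simp only [if_neg h] at hd'
    omega

theorem exists_indepPoly_comp_eq (hH : IsHexagonalSystem H) (hK : IsKekulean H) :
    ∃ (V : Type) (r : V → V → Prop) (S : Finset V), Std.Symm r ∧ S.Nonempty ∧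
      clarCoveringPolynomial H = (indepPoly r S).comp (X + 1) := by
  obtain ⟨hfin, u, p, hp, rfl⟩ := hH
  obtain ⟨m₀, hm₀⟩ := hK.exists_isMatchingIndicator
  have := finite_heightLattice (m₀ := m₀) hfin
  have := Fintype.ofFinite (heightLattice (cycleWithInterior p) m₀)
  have := nontrivial_heightLattice hp hfin hm₀
  obtain ⟨V, r, S, hr, hS, heq⟩ :=
    exists_indepPoly_eq_coverPoly (heightLattice (cycleWithInterior p) m₀)
  refine ⟨V, r, S, hr, hS, ?_⟩
  rw [← heq, coverPoly_heightLattice hfin hm₀, clarCoveringPolynomial_eq hfin]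
  simp [Polynomial.sum_comp]

end ClarPolynomial

/-! ### Real and rational roots -/

theorem aeval_indepPoly_pos {V : Type*} (r : V → V → Prop) (S : Finset V) {y : ℝ} (hy : 0 ≤ y) :
    0 < aeval y (indepPoly r S) := by
  classical
  unfold indepPoly
  rw [map_sum]
  refine Finset.sum_pos' (fun T _ => by simpa using pow_nonneg hy _) ⟨∅, ?_, ?_⟩
  · simp
  · simp

/-- The numerator of a rational root divides the constant coefficient 1, and a root is negative, so
the numerator is -1 and `t` is the denominator. -/
theorem exists_eq_neg_inv_of_aeval_indepPoly_eq_zero {V : Type*} {r : V → V → Prop} {S : Finset V}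
    {b : ℚ} (hb : aeval b (indepPoly r S) = 0) : ∃ t : ℤ, 1 ≤ t ∧ b = -(1 / (t : ℚ)) := by
  have hneg : b < 0 := by
    by_contra hge
    have h1 := aeval_indepPoly_pos r S (y := (b : ℝ)) (by exact_mod_cast not_lt.1 hge)
    have h2 : aeval (b : ℝ) (indepPoly r S) = ((aeval b (indepPoly r S) : ℚ) : ℝ) := by
      have := aeval_algebraMap_apply ℝ b (indepPoly r S)
      simpa using this
    rw [h2, hb] at h1
    simp at h1
  have hdvd := num_dvd_of_is_root hb
  rw [indepPoly_coeff_zero, ← isUnit_iff_dvd_one] at hdvd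
  have hnum : b.num = -1 := by
    have h1 : IsUnit b.num := (Rat.isFractionRingNum b).isUnit hdvd
    rcases Int.isUnit_iff.1 h1 with h | h
    · have := Rat.num_neg.2 hneg
      omega
    · exact h
  refine ⟨b.den, by exact_mod_cast b.den_pos, ?_⟩
  have h := Rat.num_div_den b
  rw [hnum] at h
  rw [Int.cast_natCast, ← neg_div]
  exact_mod_cast h.symm

theorem mainTheorem9 (H : hexLattice.Subgraph) (hH : IsHexagonalSystem H) (hK : IsKekulean H) :
    (∀ x : ℝ, -1 ≤ x → Polynomial.aeval x (clarCoveringPolynomial H) ≠ 0) ∧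
    (∃ x : ℝ, -2 ≤ x ∧ x < -1 ∧ Polynomial.aeval x (clarCoveringPolynomial H) = 0) ∧
    (∀ a : ℚ, Polynomial.aeval a (clarCoveringPolynomial H) = 0 →
      ∃ t : ℤ, 1 ≤ t ∧ a = -(((t : ℚ) + 1) / (t : ℚ))) := by
  obtain ⟨V, r, S, hr, hS, heq⟩ := exists_indepPoly_comp_eq hH hK
  have haeval : ∀ {R : Type} [CommRing R] (x : R),
      aeval x (clarCoveringPolynomial H) = aeval (x + 1) (indepPoly r S) := by
    intro R _ x
    rw [heq, aeval_comp]
    simp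
  simp only [haeval]
  refine ⟨fun x hx => (aeval_indepPoly_pos r S (by linarith)).ne', ?_, fun a ha => ?_⟩
  · obtain ⟨y, h1, h2, h3⟩ := exists_root_indepPoly (r := r) hS
    exact ⟨y - 1, by linarith, by linarith, by rwa [sub_add_cancel]⟩
  · obtain ⟨t, ht, h⟩ := exists_eq_neg_inv_of_aeval_indepPoly_eq_zero ha
    have ht' : (t : ℚ) ≠ 0 := by
      have : t ≠ 0 := by omega
      exact_mod_cast this
    refine ⟨t, ht, ?_⟩
    rw [eq_sub_of_add_eq h]
    field_simp
    ring
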